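/- Let data in $\mathbb{R}^d$ come from $J$ classes with continuous probability density functions $f_1,\dots,f_J$. For each total sample size $n$ we have independent training observations, $n_i=n_i(n)$ of them from class $i$ (with density $f_i$), $\sum_i n_i=n$, and $n_i/n\to\pi_i\in(0,1)$ as $n\to\infty$ for every $i$ (so $\sum_i\pi_i=1$). **Binary classifier.** For a majority group of $N_A$ observations, a minority group of $N_B$ observations and a point $\mathbf{x}$, let $p_0=N_B/(N_A+N_B)$, let $N_k(\mathbf{x})$ be the number of nearest neighbors of $\mathbf{x}$ needed to get $k$ neighbors from the minority group, $g_k(t)=\binom{t-1}{k-1}p_0^k(1-p_0)^{t-k}$ for $t\ge k$, and $e_k(\mathbf{x})=\sum_{k\le t<N_k(\mathbf{x})}g_k(t)+\tfrac12 g_k(N_k(\mathbf{x}))$. Over $1\le k\le k_{\max}$ put $\mathcal{E}_1=\max\{\tfrac12,\max_k e_k(\mathbf{x})\}$ and $\mathcal{E}_2=1-\min\{\tfrac12,\min_k e_k(\mathbf{x})\}$, the evidence for the majority and for the minority group. Choose the minority group if $\mathcal{E}_1<\mathcal{E}_2$ and the majority group otherwise. **OvO$+$.** Given a set of classes, take the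 one with the smallest sample size as the minority class, and classify $\mathbf{x}$ between it and each of the other classes. If no other class wins, assign $\mathbf{x}$ to the smallest class; otherwise repeat with the set of winning classes (a single winning class is the final decision). **OvR$+$.** Given a set $S$ of classes, for each $i\in S$ classify $\mathbf{x}$ between class $i$ and the union of the other classes of $S$ (the smaller of the two groups being the minority), a win giving class $i$ a vote. Repeat with the set of classes having the maximum number of votes, until a single class is left; if at some stage all (at least two) remaining classes are tied, choose among them one whose evidence against the union of the others is largest. In both methods ties between sample sizes and between evidences are resolved arbitrarily. Assume that in every binary problem, both one-vs-one and one-vs-rest, $k_{\max}=k_{\max}(n)$ (which may depend on the problem) satisfies $k_{\max}\to\infty$ and $k_{\max}/n\to0$ as $n\to\infty$. Then, for every $\mathbf{x}\in\mathbb{R}^d$, each of the two methods OvO$+$ and OvR$+$ (trained on all $J$ classes) classifies $\mathbf{x}$ to the class $\arg\max_{1\le i\le J}f_i(\mathbf{x})$ (to one of the maximizing classes, if there are several) with probability tending to $1$ as $n\to\infty$. -/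

import Mathlib

open Filter Topology MeasureTheory ProbabilityTheory

namespace NNClass

noncomputable section

/-- A training set with `J` classes: class `i` has `m i` observations in `ℝ^d`. -/
abbrev TrainingSet (d J : ℕ) (m : Fin J → ℕ) : Type :=
  (i : Fin J) → Fin (m i) → EuclideanSpace ℝ (Fin d)

/-- Number of training observations in the union of the classes in `A`. -/
def groupSize {J : ℕ} (m : Fin J → ℕ) (A : Finset (Fin J)) : ℕ := ∑ i ∈ A, m i

/-- Number of training observations from the classes in `A` at distance at most `r` from `x`. -/
def ballCount {d J : ℕ} {m : Fin J → ℕ} (T : TrainingSet d J m)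
    (x : EuclideanSpace ℝ (Fin d)) (A : Finset (Fin J)) (r : ℝ) : ℕ :=
  ∑ i ∈ A, (Finset.univ.filter fun j : Fin (m i) => dist (T i j) x ≤ r).card

/-- The number `N_k(x)` of nearest neighbors of `x` needed to get `k` neighbors from the minority
group `B`, in the two-class problem `A` (majority) against `B` (minority): the smallest size of a
closed ball neighborhood of `x` that holds at least `k` observations from `B`. (Observations at
exactly equal distances from `x` enter together.) -/
def neighborsNeeded {d J : ℕ} {m : Fin J → ℕ} (T : TrainingSet d J m)
    (x : EuclideanSpace ℝ (Fin d)) (A B : Finset (Fin J)) (k : ℕ) : ℕ :=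
  sInf {t : ℕ | ∃ r : ℝ, k ≤ ballCount T x B r ∧ t = ballCount T x A r + ballCount T x B r}

/-- The negative binomial probability mass function: the probability that exactly `t` independent
trials with success probability `p` are needed to get `k ≥ 1` successes. -/
def negBinPMF (k : ℕ) (p : ℝ) (t : ℕ) : ℝ :=
  if k ≤ t then ((t - 1).choose (k - 1) : ℝ) * p ^ k * (1 - p) ^ (t - k) else 0

/-- The adjusted p-value `e_k = ∑_{t < N} f_k(t) + f_k(N) / 2`. -/
def adjustedPValue (k : ℕ) (p : ℝ) (N : ℕ) : ℝ :=
  ∑ t ∈ Finset.range N, negBinPMF k p t + (1 / 2) * negBinPMF k p N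

/-- `e_k(x)` in the two-class problem `A` (majority) against `B` (minority); the null value of the
success probability is the sample proportion of `B`. -/
def ePValue {d J : ℕ} {m : Fin J → ℕ} (T : TrainingSet d J m)
    (x : EuclideanSpace ℝ (Fin d)) (A B : Finset (Fin J)) (k : ℕ) : ℝ :=
  adjustedPValue k ((groupSize m B : ℝ) / ((groupSize m A : ℝ) + (groupSize m B : ℝ)))
    (neighborsNeeded T x A B k)

/-- The strongest evidence `max_k e_k(x)` in favor of the majority group `A`, the running maximum
starting from `1/2`; here `1 ≤ k ≤ K`, and `k` cannot exceed the number of observations in `B`. -/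
def evidenceMajority {d J : ℕ} {m : Fin J → ℕ} (T : TrainingSet d J m)
    (x : EuclideanSpace ℝ (Fin d)) (A B : Finset (Fin J)) (K : ℕ) : ℝ :=
  (Finset.Icc 1 (min K (groupSize m B))).fold max (1 / 2) (ePValue T x A B)

/-- The strongest evidence `1 - min_k e_k(x)` in favor of the minority group `B`, the running
minimum starting from `1/2`. -/
def evidenceMinority {d J : ℕ} {m : Fin J → ℕ} (T : TrainingSet d J m)
    (x : EuclideanSpace ℝ (Fin d)) (A B : Finset (Fin J)) (K : ℕ) : ℝ :=
  1 - (Finset.Icc 1 (min K (groupSize m B))).fold min (1 / 2) (ePValue T x A B)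

/-- The binary classifier assigns `x` to the minority group `B` (otherwise to the majority group
`A`). -/
def MinorityWins {d J : ℕ} {m : Fin J → ℕ} (T : TrainingSet d J m)
    (x : EuclideanSpace ℝ (Fin d)) (A B : Finset (Fin J)) (K : ℕ) : Prop :=
  evidenceMajority T x A B K < evidenceMinority T x A B K

/-- An arbitrary rule for resolving ties: `pick` selects one class from a set of tied classes, and
`classIsMinority S i` says whether class `i` or the union of the other classes of `S` plays the
role of the minority class when both have the same sample size. -/
structure TieRule (J : ℕ) where
  pick : Finset (Fin J) → Fin J
  pick_mem : ∀ S : Finset (Fin J), S.Nonempty → pick S ∈ S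
  classIsMinority : Finset (Fin J) → Fin J → Bool

/-! ### One versus one -/

/-- The class of `S` with the smallest sample size. -/
def smallestClass {J : ℕ} (m : Fin J → ℕ) (tie : TieRule J) (S : Finset (Fin J)) : Fin J :=
  tie.pick (S.filter fun i => ∀ j ∈ S, m i ≤ m j)

theorem smallestClass_mem {J : ℕ} (m : Fin J → ℕ) (tie : TieRule J) (S : Finset (Fin J))
    (hS : S.Nonempty) : smallestClass m tie S ∈ S := by
  obtain ⟨i, hi, hmin⟩ := S.exists_min_image m hS
  have hne : (S.filter fun i => ∀ j ∈ S, m i ≤ m j).Nonempty :=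
    ⟨i, Finset.mem_filter.2 ⟨hi, hmin⟩⟩
  exact (Finset.mem_filter.1 (tie.pick_mem _ hne)).1

open Classical in
/-- The classes of `S` that win over the smallest class `c` of `S` in the binary classifications
with `c` as the minority class; `K j c` is the value of `k_max` for class `j` against `c`. -/
def ovoWinners {d J : ℕ} {m : Fin J → ℕ} (tie : TieRule J) (K : Fin J → Fin J → ℕ)
    (T : TrainingSet d J m) (x : EuclideanSpace ℝ (Fin d)) (S : Finset (Fin J)) :
    Finset (Fin J) :=
  (S.erase (smallestClass m tie S)).filter fun j =>
    ¬ MinorityWins T x {j} {smallestClass m tie S} (K j (smallestClass m tie S))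

open Classical in
theorem ovoWinners_card_lt {d J : ℕ} {m : Fin J → ℕ} (tie : TieRule J)
    (K : Fin J → Fin J → ℕ) (T : TrainingSet d J m) (x : EuclideanSpace ℝ (Fin d))
    (S : Finset (Fin J)) (h : ¬ ovoWinners tie K T x S = ∅) :
    (ovoWinners tie K T x S).card < S.card := by
  have hS : S.Nonempty := by
    obtain ⟨i, hi⟩ := Finset.nonempty_iff_ne_empty.2 h
    exact ⟨i, Finset.mem_of_mem_erase (Finset.mem_filter.1 hi).1⟩
  exact lt_of_le_of_lt (Finset.card_filter_le _ _)
    (Finset.card_erase_lt_of_mem (smallestClass_mem m tie S hS))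

/-- The OvO+ classifier for the classes in `S`: if no class wins over the smallest class of `S`,
assign `x` to the smallest class; otherwise repeat with the winning classes only. -/
def ovoPlusOn {d J : ℕ} {m : Fin J → ℕ} (tie : TieRule J) (K : Fin J → Fin J → ℕ)
    (T : TrainingSet d J m) (x : EuclideanSpace ℝ (Fin d)) (S : Finset (Fin J)) : Fin J :=
  if _h : ovoWinners tie K T x S = ∅ then smallestClass m tie S
  else ovoPlusOn tie K T x (ovoWinners tie K T x S)
termination_by S.card
decreasing_by exact ovoWinners_card_lt tie K T x S _h

/-- The OvO+ classifier. -/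
def ovoPlus {d J : ℕ} {m : Fin J → ℕ} (tie : TieRule J) (K : Fin J → Fin J → ℕ)
    (T : TrainingSet d J m) (x : EuclideanSpace ℝ (Fin d)) : Fin J :=
  ovoPlusOn tie K T x Finset.univ

/-! ### One versus rest -/

/-- In the problem of class `i` against the union of the other classes of `S`, class `i` is the
minority class. -/
def OvrClassIsMinority {J : ℕ} (m : Fin J → ℕ) (tie : TieRule J) (S : Finset (Fin J))
    (i : Fin J) : Prop :=
  m i < groupSize m (S.erase i) ∨
    (m i = groupSize m (S.erase i) ∧ tie.classIsMinority S i = true)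

open Classical in
/-- Class `i` wins over the union of the other classes of `S`; `K` is the value of `k_max`. -/
def OvrWins {d J : ℕ} {m : Fin J → ℕ} (tie : TieRule J) (K : ℕ) (T : TrainingSet d J m)
    (x : EuclideanSpace ℝ (Fin d)) (S : Finset (Fin J)) (i : Fin J) : Prop :=
  if OvrClassIsMinority m tie S i then MinorityWins T x (S.erase i) {i} K
  else ¬ MinorityWins T x {i} (S.erase i) K

open Classical in
/-- The strongest evidence in favor of class `i` against the union of the other classes of `S`. -/
def ovrEvidence {d J : ℕ} {m : Fin J → ℕ} (tie : TieRule J) (K : ℕ) (T : TrainingSet d J m)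
    (x : EuclideanSpace ℝ (Fin d)) (S : Finset (Fin J)) (i : Fin J) : ℝ :=
  if OvrClassIsMinority m tie S i then evidenceMinority T x (S.erase i) {i} K
  else evidenceMajority T x {i} (S.erase i) K

open Classical in
/-- Votes of class `i` in the one-vs-rest problems for `S`. (If each defeat of a class also gave
a vote to every other class, the votes would be an increasing function of the present ones.) -/
def ovrVotes {d J : ℕ} {m : Fin J → ℕ} (tie : TieRule J) (K : Finset (Fin J) → Fin J → ℕ)
    (T : TrainingSet d J m) (x : EuclideanSpace ℝ (Fin d)) (S : Finset (Fin J)) (i : Fin J) : ℕ :=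
  if OvrWins tie (K S i) T x S i then 1 else 0

/-- The classes of `S` with the maximum number of votes; `K S i` is the value of `k_max` for
class `i` against the union of the other classes of `S`. -/
def ovrLeaders {d J : ℕ} {m : Fin J → ℕ} (tie : TieRule J) (K : Finset (Fin J) → Fin J → ℕ)
    (T : TrainingSet d J m) (x : EuclideanSpace ℝ (Fin d)) (S : Finset (Fin J)) :
    Finset (Fin J) :=
  S.filter fun i => ∀ j ∈ S, ovrVotes tie K T x S j ≤ ovrVotes tie K T x S i

open Classical in
/-- A class of `S` with the maximum evidence. -/
def ovrByEvidence {d J : ℕ} {m : Fin J → ℕ} (tie : TieRule J) (K : Finset (Fin J) → Fin J → ℕ)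
    (T : TrainingSet d J m) (x : EuclideanSpace ℝ (Fin d)) (S : Finset (Fin J)) : Fin J :=
  tie.pick (S.filter fun i =>
    ∀ j ∈ S, ovrEvidence tie (K S j) T x S j ≤ ovrEvidence tie (K S i) T x S i)

theorem ovrLeaders_card_lt {d J : ℕ} {m : Fin J → ℕ} (tie : TieRule J)
    (K : Finset (Fin J) → Fin J → ℕ) (T : TrainingSet d J m) (x : EuclideanSpace ℝ (Fin d))
    (S : Finset (Fin J)) (h : ¬ ovrLeaders tie K T x S = S) :
    (ovrLeaders tie K T x S).card < S.card :=
  Finset.card_lt_card ((Finset.filter_subset _ _).ssubset_of_ne h)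

/-- The OvR+ classifier for the classes in `S`: repeat with the classes that have the maximum
number of votes until one class is left; if all classes of `S` are tied, choose by the maximum
evidence. -/
def ovrPlusOn {d J : ℕ} {m : Fin J → ℕ} (tie : TieRule J) (K : Finset (Fin J) → Fin J → ℕ)
    (T : TrainingSet d J m) (x : EuclideanSpace ℝ (Fin d)) (S : Finset (Fin J)) : Fin J :=
  if _h : ovrLeaders tie K T x S = S then ovrByEvidence tie K T x S
  else ovrPlusOn tie K T x (ovrLeaders tie K T x S)
termination_by S.card
decreasing_by exact ovrLeaders_card_lt tie K T x S _h

/-- The OvR+ classifier. -/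
def ovrPlus {d J : ℕ} {m : Fin J → ℕ} (tie : TieRule J) (K : Finset (Fin J) → Fin J → ℕ)
    (T : TrainingSet d J m) (x : EuclideanSpace ℝ (Fin d)) : Fin J :=
  ovrPlusOn tie K T x Finset.univ

end

end NNClass

namespace NNClass

/-! For a group `A` put `w_A = ∑ π i` and `b_A = ∑ π i * f i x`, sums over `A`. Close to `x` the two
groups appear in the ratio `b_A : b_B`, so `N_k / k` is near `1 + b_A / b_B` (for `b_B > 0`), while
under the null share `p = w_B / (w_A + w_B)` it would be near `1 / p = 1 + w_A / w_B`. Hence the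
group with the larger average density `b / w` should win.

Two families of Chernoff bounds make this quantitative. If `N_k` is at least `C * k` with `C > 1 /
p`, or at most `C * k` with `C < 1 / p`, negative binomial tails put `e_k` within `β ^ k` of `1`,
respectively `0`. Bounds for the number of observations in a small ball of volume proportional to `k
/ n` put `N_k` on the correct side outside an event of probability at most `2 * exp (-(c * k))`.
These probabilities are summable, so all `k₀ ≤ k ≤ k_max` behave simultaneously, with failure
probability small uniformly in `n`. The finitely many `k < k₀` may favour the wrong group, but only
with evidence at most `1 - δ` for a fixed `δ > 0`, whereas at `k = k_max → ∞` the evidence for the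
right group exceeds that. This gives `tendsto_measure_minorityWins` and
`tendsto_measure_not_minorityWins`.

The multi-class rules are then deterministic: `le_ovoPlusOn` and `le_ovrPlusOn` show that they
return a maximizing class once finitely many strict comparisons come out right. Comparisons between
equal densities, or of an intermediate class with a union, are not controlled and need not be. -/

/-! ### Tails of the negative binomial distribution. -/

theorem negBinPMF_nonneg {p : ℝ} (hp0 : 0 ≤ p) (hp1 : p ≤ 1) (k t : ℕ) :
    0 ≤ negBinPMF k p t := by
  unfold negBinPMF
  have : 0 ≤ 1 - p := by linarith
  split_ifs <;> positivity

/-- After the shift `t = j + k` this is the negative binomial series. It is used at `z = 1` for the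
total mass and at `z = exp s` for the Chernoff bounds. -/
theorem hasSum_negBinPMF_mul_pow {p z : ℝ} {k : ℕ} (hk : 1 ≤ k) (hz : |(1 - p) * z| < 1) :
    HasSum (fun t => negBinPMF k p t * z ^ t) ((p * z / (1 - (1 - p) * z)) ^ k) := by
  have h := (hasSum_choose_mul_geometric_of_norm_lt_one (𝕜 := ℝ) (k - 1)
    (r := (1 - p) * z) (by simpa using hz)).mul_left ((p * z) ^ k)
  rw [← (add_left_injective k).hasSum_iff]
  · have hs : (p * z / (1 - (1 - p) * z)) ^ k =
        (p * z) ^ k * (1 / (1 - (1 - p) * z) ^ (k - 1 + 1)) := by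
      rw [Nat.sub_add_cancel hk, div_pow]
      ring
    have hf : (fun t => negBinPMF k p t * z ^ t) ∘ (fun j => j + k) = fun j =>
        (p * z) ^ k * (((j + (k - 1)).choose (k - 1) : ℕ) * ((1 - p) * z) ^ j) := by
      ext j
      have h1 : j + k - 1 = j + (k - 1) := by omega
      simp only [negBinPMF, Function.comp_apply, Nat.le_add_left, if_true, h1,
        Nat.add_sub_cancel, pow_add, mul_pow]
      ring
    rw [hf, hs]
    exact h
  · intro t ht
    have : ¬ k ≤ t := fun h => ht ⟨t - k, by simp; omega⟩
    simp [negBinPMF, this]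

theorem hasSum_negBinPMF {p : ℝ} (hp0 : 0 < p) (hp1 : p ≤ 1) {k : ℕ} (hk : 1 ≤ k) :
    HasSum (negBinPMF k p) 1 := by
  have h := hasSum_negBinPMF_mul_pow (p := p) (z := 1) hk
    (by rw [abs_lt]; constructor <;> linarith)
  have h1 : p * 1 / (1 - (1 - p) * 1) = 1 := by
    rw [mul_one, mul_one, sub_sub_cancel, div_self hp0.ne']
  rw [h1, one_pow] at h
  simpa using h

/-- Exponential rate in the Chernoff bound for the negative binomial distribution. -/
noncomputable def negBinRate (c s p : ℝ) : ℝ :=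
  p * Real.exp ((1 - c) * s) / (1 - (1 - p) * Real.exp s)

theorem negBinRate_pow_eq (c s p : ℝ) (k : ℕ) :
    (p * Real.exp s / (1 - (1 - p) * Real.exp s)) ^ k * Real.exp (-(s * (c * k))) =
      negBinRate c s p ^ k := by
  have h : Real.exp (-(s * (c * k))) = Real.exp (-(c * s)) ^ k := by
    rw [← Real.exp_nat_mul]; ring_nf
  rw [h, ← mul_pow, negBinRate]
  congr 1
  have : Real.exp ((1 - c) * s) = Real.exp s * Real.exp (-(c * s)) := by
    rw [← Real.exp_add]; ring_nf
  rw [this]; ring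

/-- Exponential Markov inequality: for `t ≥ N ≥ c * k` the factor `exp (s * (t - c * k))` is at
least `1`. The half weight at `N` only decreases `1 - e_k` below the tail sum over `t ≥ N`. -/
theorem one_sub_adjustedPValue_le {p c s : ℝ} (hp0 : 0 < p) (hp1 : p ≤ 1) (hs : 0 ≤ s)
    (hps : (1 - p) * Real.exp s < 1) {k N : ℕ} (hk : 1 ≤ k) (hN : c * k ≤ N) :
    1 - adjustedPValue k p N ≤ negBinRate c s p ^ k := by
  have hz : |(1 - p) * Real.exp s| < 1 := by
    rwa [abs_of_nonneg (mul_nonneg (by linarith) (Real.exp_pos _).le)]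
  have h2 := (hasSum_negBinPMF_mul_pow hk hz).mul_right (Real.exp (-(s * (c * k))))
  rw [negBinRate_pow_eq] at h2
  have h1 := (hasSum_negBinPMF hp0 hp1 hk).sub
    (hasSum_sum_of_ne_finset_zero (s := Finset.range N)
      (f := fun t => if t < N then negBinPMF k p t else 0)
      (fun t ht => by simp only [Finset.mem_range] at ht; simp [ht]))
  have h3 := hasSum_le (fun t => ?_) h1 h2
  · refine le_trans ?_ h3
    have : ∑ t ∈ Finset.range N, (if t < N then negBinPMF k p t else 0) =
        ∑ t ∈ Finset.range N, negBinPMF k p t :=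
      Finset.sum_congr rfl fun t ht => if_pos (Finset.mem_range.1 ht)
    rw [this, adjustedPValue]
    linarith [negBinPMF_nonneg hp0.le hp1 k N]
  · have h0 := negBinPMF_nonneg hp0.le hp1 k t
    split_ifs with ht
    · simp only [sub_self]; positivity
    · rw [sub_zero, mul_assoc, ← Real.exp_nat_mul, ← Real.exp_add]
      refine le_mul_of_one_le_right h0 (Real.one_le_exp ?_)
      have : (N : ℝ) ≤ t := by exact_mod_cast not_lt.1 ht
      nlinarith

theorem adjustedPValue_le_sum {p : ℝ} (hp0 : 0 ≤ p) (hp1 : p ≤ 1) (k N : ℕ) :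
    adjustedPValue k p N ≤ ∑ t ∈ Finset.range (N + 1), negBinPMF k p t := by
  rw [Finset.sum_range_succ, adjustedPValue]
  linarith [negBinPMF_nonneg hp0 hp1 k N]

theorem adjustedPValue_le_negBinRate_pow {p c s : ℝ} (hp0 : 0 < p) (hp1 : p ≤ 1) (hs : s ≤ 0)
    (hps : (1 - p) * Real.exp s < 1) {k N : ℕ} (hk : 1 ≤ k) (hN : N ≤ c * k) :
    adjustedPValue k p N ≤ negBinRate c s p ^ k := by
  have hz : |(1 - p) * Real.exp s| < 1 := by
    rwa [abs_of_nonneg (mul_nonneg (by linarith) (Real.exp_pos _).le)]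
  have h2 := (hasSum_negBinPMF_mul_pow hk hz).mul_right (Real.exp (-(s * (c * k))))
  rw [negBinRate_pow_eq] at h2
  have h0 := negBinPMF_nonneg hp0.le hp1 k
  refine (adjustedPValue_le_sum hp0.le hp1 k N).trans (le_trans ?_
    (sum_le_hasSum (Finset.range (N + 1)) (fun t _ => ?_) h2))
  · refine Finset.sum_le_sum fun t ht => ?_
    rw [mul_assoc, ← Real.exp_nat_mul, ← Real.exp_add]
    refine le_mul_of_one_le_right (h0 t) (Real.one_le_exp ?_)
    have : (t : ℝ) ≤ N := by exact_mod_cast Nat.lt_succ_iff.1 (Finset.mem_range.1 ht)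
    nlinarith
  · have := h0 t
    positivity

theorem pow_mul_pow_le_negBinPMF {p : ℝ} (hp0 : 0 ≤ p) (hp1 : p ≤ 1) {k t : ℕ} (hk : 1 ≤ k)
    (hkt : k ≤ t) : p ^ k * (1 - p) ^ (t - k) ≤ negBinPMF k p t := by
  have h1 : 0 ≤ 1 - p := by linarith
  rw [negBinPMF, if_pos hkt, mul_assoc]
  refine le_mul_of_one_le_left (by positivity) ?_
  exact_mod_cast Nat.choose_pos (by omega)

/-- The atom at `t = k` is counted with weight at least one half, whatever `N` is. This keeps `e_k`
away from `0` for small `k`. -/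
theorem half_pow_le_adjustedPValue {p : ℝ} (hp0 : 0 ≤ p) (hp1 : p ≤ 1) {k N : ℕ} (hk : 1 ≤ k)
    (hkN : k ≤ N) : (1 / 2) * p ^ k ≤ adjustedPValue k p N := by
  have h0 := negBinPMF_nonneg hp0 hp1 k
  have h1 : p ^ k ≤ negBinPMF k p k := by
    simpa using pow_mul_pow_le_negBinPMF hp0 hp1 hk le_rfl
  have hp : 0 ≤ p ^ k := by positivity
  rw [adjustedPValue]
  rcases hkN.eq_or_lt with rfl | h
  · have := Finset.sum_nonneg fun t (_ : t ∈ Finset.range k) => h0 t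
    linarith
  · have := Finset.single_le_sum (fun t _ => h0 t) (Finset.mem_range.2 h)
    linarith [h0 N]

/-- The atom at `M > N` is missing from `e_k`. This keeps `e_k` away from `1` for small `k`, but
only once `N` is bounded. -/
theorem adjustedPValue_le_one_sub {p : ℝ} (hp0 : 0 < p) (hp1 : p ≤ 1) {k N M : ℕ} (hk : 1 ≤ k)
    (hkM : k ≤ M) (hNM : N < M) : adjustedPValue k p N ≤ 1 - (p * (1 - p)) ^ M := by
  have h0 := negBinPMF_nonneg hp0.le hp1 k
  have h1 := sum_le_hasSum (Finset.range (M + 1)) (fun t _ => h0 t) (hasSum_negBinPMF hp0 hp1 hk)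
  rw [Finset.sum_range_succ] at h1
  have h2 := (adjustedPValue_le_sum hp0.le hp1 k N).trans
    (Finset.sum_le_sum_of_subset_of_nonneg (Finset.range_mono (show N + 1 ≤ M from hNM))
      fun t _ _ => h0 t)
  have hq : 0 ≤ 1 - p := by linarith
  have h3 : (p * (1 - p)) ^ M ≤ negBinPMF k p M := by
    refine le_trans ?_ (pow_mul_pow_le_negBinPMF hp0.le hp1 hk hkM)
    rw [mul_pow]
    exact mul_le_mul (pow_le_pow_of_le_one hp0.le hp1 hkM)
      (pow_le_pow_of_le_one hq (by linarith) (Nat.sub_le _ _)) (by positivity) (by positivity)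
  linarith

/-- A function with nonzero derivative at `0` takes smaller values on one side of `0`. -/
theorem exists_lt_of_hasDerivAt_ne_zero {g : ℝ → ℝ} {D : ℝ} (hg : HasDerivAt g D 0) :
    (D < 0 → ∃ s > 0, g s < g 0) ∧ (0 < D → ∃ s < 0, g s < g 0) := by
  refine ⟨fun hD => ?_, fun hD => ?_⟩
  · have h := hg.tendsto_slope_zero_right.eventually (gt_mem_nhds hD)
    obtain ⟨s, hs, hs0⟩ := (h.and self_mem_nhdsWithin).exists
    have hs0 : 0 < s := hs0
    refine ⟨s, hs0, ?_⟩
    simp only [zero_add, smul_eq_mul] at hs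
    nlinarith [mul_inv_cancel₀ hs0.ne', mul_pos hs0 hs0, inv_pos.2 hs0,
      (mul_neg_iff.1 hs).resolve_right (fun h => by linarith [inv_pos.2 hs0, h.1])]
  · have h := hg.tendsto_slope_zero_left.eventually (lt_mem_nhds hD)
    obtain ⟨s, hs, hs0⟩ := (h.and self_mem_nhdsWithin).exists
    have hs0 : s < 0 := hs0
    refine ⟨s, hs0, ?_⟩
    simp only [zero_add, smul_eq_mul] at hs
    have := (mul_pos_iff.1 hs).resolve_left (fun h => by linarith [inv_lt_zero.2 hs0, h.1])
    linarith [this.2]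

/-- Clearing the denominator, `negBinRate c s p < 1` says that this function is below `1`, its value
at `0`. The sign of `1 - p * c` tells on which side of `0` such an `s` exists, so no optimization
over `s` is needed. -/
theorem hasDerivAt_negBinTilt (c p : ℝ) :
    HasDerivAt (fun s => p * Real.exp ((1 - c) * s) + (1 - p) * Real.exp s) (1 - p * c) 0 := by
  have h1 : HasDerivAt (fun s : ℝ => Real.exp ((1 - c) * s)) (1 - c) 0 := by
    simpa using ((hasDerivAt_id (0 : ℝ)).const_mul (1 - c)).exp
  have h2 : HasDerivAt (fun s : ℝ => Real.exp s) 1 0 := by simpa using Real.hasDerivAt_exp 0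
  exact ((h1.const_mul p).add (h2.const_mul (1 - p))).congr_deriv (by ring)

/-- The null probability is a sample proportion that only converges to `p`, so one `β` must serve a
whole neighbourhood; `s` stays fixed and continuity in `q` does the rest. -/
theorem eventually_negBinRate_le {c s p : ℝ}
    (h : p * Real.exp ((1 - c) * s) + (1 - p) * Real.exp s < 1) (hp : 0 < p) :
    ∃ β : ℝ, 0 < β ∧ β < 1 ∧ ∀ᶠ q in 𝓝 p, (1 - q) * Real.exp s < 1 ∧ 0 ≤ negBinRate c s q ∧
      negBinRate c s q ≤ β := by
  have hpos : 0 < p * Real.exp ((1 - c) * s) := by positivity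
  have hden : 0 < 1 - (1 - p) * Real.exp s := by linarith
  have hrate : negBinRate c s p < 1 := by
    rw [negBinRate, div_lt_one hden]; linarith
  have hrate0 : 0 < negBinRate c s p := div_pos hpos hden
  obtain ⟨β, hβ, hβ1⟩ := exists_between hrate
  have hc : ContinuousAt (negBinRate c s) p := by
    unfold negBinRate
    exact ContinuousAt.div (by fun_prop) (by fun_prop) hden.ne'
  refine ⟨β, hrate0.trans hβ, hβ1, ?_⟩
  have hc' : ContinuousAt (fun q => (1 - q) * Real.exp s) p := by fun_prop
  filter_upwards [hc.eventually (gt_mem_nhds hβ), hc.eventually (lt_mem_nhds hrate0),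
    hc'.eventually (gt_mem_nhds (show (1 - p) * Real.exp s < 1 by linarith))] with q h1 h2 h3
  exact ⟨h3, h2.le, h1.le⟩

theorem eventually_one_sub_adjustedPValue_le {p c : ℝ} (hp0 : 0 < p) (hp1 : p < 1)
    (hpc : 1 < p * c) : ∃ β : ℝ, 0 < β ∧ β < 1 ∧ ∀ᶠ q in 𝓝 p, ∀ k N : ℕ, 1 ≤ k → c * k ≤ N →
      1 - adjustedPValue k q N ≤ β ^ k := by
  obtain ⟨s, hs, h⟩ := (exists_lt_of_hasDerivAt_ne_zero (hasDerivAt_negBinTilt c p)).1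
    (by linarith)
  simp only [mul_zero, Real.exp_zero, mul_one, add_sub_cancel] at h
  obtain ⟨β, hβ0, hβ1, hev⟩ := eventually_negBinRate_le h hp0
  refine ⟨β, hβ0, hβ1, ?_⟩
  filter_upwards [hev, lt_mem_nhds hp0, gt_mem_nhds hp1] with q hq hq0 hq1 k N hk hN
  exact (one_sub_adjustedPValue_le hq0 hq1.le hs.le hq.1 hk hN).trans
    (pow_le_pow_left₀ hq.2.1 hq.2.2 k)

theorem eventually_adjustedPValue_le {p c : ℝ} (hp0 : 0 < p) (hp1 : p < 1)
    (hpc : p * c < 1) : ∃ β : ℝ, 0 < β ∧ β < 1 ∧ ∀ᶠ q in 𝓝 p, ∀ k N : ℕ, 1 ≤ k → N ≤ c * k →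
      adjustedPValue k q N ≤ β ^ k := by
  obtain ⟨s, hs, h⟩ := (exists_lt_of_hasDerivAt_ne_zero (hasDerivAt_negBinTilt c p)).2
    (by linarith)
  simp only [mul_zero, Real.exp_zero, mul_one, add_sub_cancel] at h
  obtain ⟨β, hβ0, hβ1, hev⟩ := eventually_negBinRate_le h hp0
  refine ⟨β, hβ0, hβ1, ?_⟩
  filter_upwards [hev, lt_mem_nhds hp0, gt_mem_nhds hp1] with q hq hq0 hq1 k N hk hN
  exact (adjustedPValue_le_negBinRate_pow hq0 hq1.le hs.le hq.1 hk hN).trans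
    (pow_le_pow_left₀ hq.2.1 hq.2.2 k)

section

/-! ### Small balls -/

theorem withDensity_real_closedBall_sub_le {d : ℕ} {f : EuclideanSpace ℝ (Fin d) → ℝ}
    (hf : Continuous f) (hf0 : ∀ y, 0 ≤ f y) (x : EuclideanSpace ℝ (Fin d)) {r ε : ℝ}
    (h : ∀ y ∈ Metric.closedBall x r, |f y - f x| ≤ ε) :
    |((volume : Measure (EuclideanSpace ℝ (Fin d))).withDensity
        fun y => ENNReal.ofReal (f y)).real (Metric.closedBall x r) -
      f x * volume.real (Metric.closedBall x r)| ≤ ε * volume.real (Metric.closedBall x r) := by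
  have hint : IntegrableOn f (Metric.closedBall x r) :=
    hf.continuousOn.integrableOn_compact (isCompact_closedBall x r)
  have hfin : volume (Metric.closedBall x r) < ⊤ := measure_closedBall_lt_top
  have h1 : ((volume : Measure (EuclideanSpace ℝ (Fin d))).withDensity
        fun y => ENNReal.ofReal (f y)).real (Metric.closedBall x r) =
      ∫ y in Metric.closedBall x r, f y := by
    rw [measureReal_def, withDensity_apply _ measurableSet_closedBall,
      ← ofReal_integral_eq_lintegral_ofReal hint (ae_of_all _ hf0),
      ENNReal.toReal_ofReal (integral_nonneg hf0)]
  have h2 : ∫ y in Metric.closedBall x r, (f y - f x) =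
      (∫ y in Metric.closedBall x r, f y) - f x * volume.real (Metric.closedBall x r) := by
    rw [integral_sub hint (integrableOn_const hfin.ne), setIntegral_const, smul_eq_mul, mul_comm]
  rw [h1, ← h2]
  exact norm_setIntegral_le_of_norm_le_const (f := fun y => f y - f x) hfin h

theorem exists_closedBall_volume_eq {d : ℕ} (hd : 0 < d) (x : EuclideanSpace ℝ (Fin d)) {v : ℝ}
    (hv : 0 < v) :
    ∃ r, (volume : Measure (EuclideanSpace ℝ (Fin d))).real (Metric.closedBall x r) = v := by
  set V := (volume : Measure (EuclideanSpace ℝ (Fin d))).real (Metric.ball 0 1) with hV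
  have hV0 : 0 < V :=
    ENNReal.toReal_pos (Metric.measure_ball_pos _ _ one_pos).ne' measure_ball_lt_top.ne
  have hr : 0 ≤ (v / V) ^ ((1 : ℝ) / d) := by positivity
  refine ⟨_, (Measure.addHaar_real_closedBall volume x hr).trans ?_⟩
  rw [finrank_euclideanSpace_fin, ← hV, ← Real.rpow_natCast, ← Real.rpow_mul (by positivity),
    one_div_mul_cancel (by positivity), Real.rpow_one, div_mul_cancel₀ _ hV0.ne']

/-- Balls are indexed by volume rather than radius, since the expected counts are linear in the
volume to leading order. The same ball serves all classes. -/
theorem exists_closedBall_withDensity_sub_le {d J : ℕ} (hd : 0 < d)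
    {f : Fin J → EuclideanSpace ℝ (Fin d) → ℝ} (hf : ∀ i, Continuous (f i))
    (hf0 : ∀ i y, 0 ≤ f i y) (x : EuclideanSpace ℝ (Fin d)) {ε : ℝ} (hε : 0 < ε) :
    ∃ v₀ > 0, ∀ v, 0 < v → v < v₀ → ∃ r, ∀ i,
      |((volume : Measure (EuclideanSpace ℝ (Fin d))).withDensity
        fun y => ENNReal.ofReal (f i y)).real (Metric.closedBall x r) - f i x * v| ≤ ε * v := by
  have h1 : ∀ᶠ y in 𝓝 x, ∀ i, |f i y - f i x| < ε := by
    rw [eventually_all]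
    exact fun i => (Metric.tendsto_nhds.1 (hf i).continuousAt ε hε)
  obtain ⟨δ, hδ, hball⟩ := Metric.eventually_nhds_iff.1 h1
  refine ⟨volume.real (Metric.ball x δ),
    ENNReal.toReal_pos (Metric.measure_ball_pos _ _ hδ).ne' measure_ball_lt_top.ne,
    fun v hv hv0 => ?_⟩
  obtain ⟨r, hr⟩ := exists_closedBall_volume_eq hd x hv
  have hrδ : r < δ := by
    by_contra! hle
    have := measureReal_mono (μ := (volume : Measure (EuclideanSpace ℝ (Fin d))))
      ((Metric.ball_subset_closedBall (x := x)).trans (Metric.closedBall_subset_closedBall hle))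
      measure_closedBall_lt_top.ne
    linarith
  refine ⟨r, fun i => ?_⟩
  have := withDensity_real_closedBall_sub_le (hf i) (hf0 i) x (r := r) (ε := ε) fun y hy =>
    (hball ((Metric.mem_closedBall.1 hy).trans_lt hrδ) i).le
  rwa [hr] at this

/-! ### Chernoff bounds for the number of observations in a ball -/

/-- A training set of independent observations, those of class `i` with distribution `ν i`. -/
structure IsIndepSample {d J : ℕ} {Ω : Type*} [MeasurableSpace Ω] (μ : Measure Ω)
    (ν : Fin J → Measure (EuclideanSpace ℝ (Fin d))) (m : Fin J → ℕ)
    (X : (i : Fin J) → Fin (m i) → Ω → EuclideanSpace ℝ (Fin d)) : Prop where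
  law : ∀ i j, HasLaw (X i j) (ν i) μ
  indep : iIndepFun (fun p : (i : Fin J) × Fin (m i) => X p.1 p.2) μ

/-- The expected number of observations from the classes in `A` in a closed ball. -/
noncomputable def meanCount {d J : ℕ} (ν : Fin J → Measure (EuclideanSpace ℝ (Fin d)))
    (m : Fin J → ℕ) (x : EuclideanSpace ℝ (Fin d)) (A : Finset (Fin J)) (r : ℝ) : ℝ :=
  ∑ i ∈ A, m i * (ν i).real (Metric.closedBall x r)

theorem exp_mul_indicator_one {α : Type*} (B : Set α) (s : ℝ) (a : α) :
    Real.exp (s * B.indicator 1 a) = 1 + (Real.exp s - 1) * B.indicator 1 a := by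
  by_cases h : a ∈ B <;> simp [h]

theorem mgf_indicator_comp {Ω E : Type*} [MeasurableSpace Ω] [MeasurableSpace E] {μ : Measure Ω}
    [IsProbabilityMeasure μ] {ν : Measure E} {Y : Ω → E} (hY : HasLaw Y ν μ) {B : Set E}
    (hB : MeasurableSet B) (s : ℝ) :
    mgf (fun ω => B.indicator (1 : E → ℝ) (Y ω)) μ s = 1 + (Real.exp s - 1) * ν.real B := by
  have : IsProbabilityMeasure ν := by
    rw [← hY.map_eq]; exact Measure.isProbabilityMeasure_map hY.aemeasurable
  have hint : Integrable (B.indicator (1 : E → ℝ)) ν :=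
    (integrable_const (1 : ℝ)).indicator hB
  rw [mgf]
  simp only [exp_mul_indicator_one]
  have h := integral_map hY.aemeasurable (μ := μ)
    (f := fun y => 1 + (Real.exp s - 1) * B.indicator (1 : E → ℝ) y)
    (Measurable.aestronglyMeasurable (by
      have : Measurable (B.indicator (1 : E → ℝ)) := measurable_const.indicator hB
      fun_prop))
  rw [← h, hY.map_eq, integral_add (integrable_const _) (hint.const_mul _), integral_const_mul,
    integral_indicator_one hB]
  simp

variable {d J : ℕ} {Ω : Type*} [MeasurableSpace Ω] {μ : Measure Ω}
  {ν : Fin J → Measure (EuclideanSpace ℝ (Fin d))} {m : Fin J → ℕ}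
  {X : (i : Fin J) → Fin (m i) → Ω → EuclideanSpace ℝ (Fin d)}

theorem ballCount_eq_sum_indicator (T : TrainingSet d J m) (x : EuclideanSpace ℝ (Fin d))
    (A : Finset (Fin J)) (r : ℝ) :
    (ballCount T x A r : ℝ) = ∑ p ∈ A.sigma fun i => (Finset.univ : Finset (Fin (m i))),
      (Metric.closedBall x r).indicator 1 (T p.1 p.2) := by
  rw [ballCount, Finset.sum_sigma, Nat.cast_sum]
  refine Finset.sum_congr rfl fun i _ => ?_
  rw [Finset.card_filter, Nat.cast_sum]
  refine Finset.sum_congr rfl fun j _ => ?_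
  by_cases h : dist (T i j) x ≤ r <;> simp [h]

theorem aemeasurable_ballCount (hX : IsIndepSample μ ν m X) (x : EuclideanSpace ℝ (Fin d))
    (A : Finset (Fin J)) (r : ℝ) :
    AEMeasurable (fun ω => (ballCount (fun i j => X i j ω) x A r : ℝ)) μ := by
  simp only [ballCount_eq_sum_indicator]
  refine Finset.aemeasurable_fun_sum _ fun p _ => ?_
  exact (measurable_const.indicator measurableSet_closedBall).comp_aemeasurable
    (hX.law p.1 p.2).aemeasurable

/-- The count is a sum of independent indicators with class-dependent probabilities. By `1 + y ≤ exp
y` its moment generating function is dominated by that of a Poisson variable with the same mean, so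
only the total mean matters. -/
theorem mgf_ballCount_le [IsProbabilityMeasure μ] (hX : IsIndepSample μ ν m X) (x : EuclideanSpace ℝ (Fin d))
    (A : Finset (Fin J)) (r s : ℝ) :
    mgf (fun ω => (ballCount (fun i j => X i j ω) x A r : ℝ)) μ s ≤
      Real.exp ((Real.exp s - 1) * meanCount ν m x A r) := by
  have hmeas : Measurable ((Metric.closedBall x r).indicator
    (1 : EuclideanSpace ℝ (Fin d) → ℝ)) := measurable_const.indicator measurableSet_closedBall
  have hsum : (fun ω => (ballCount (fun i j => X i j ω) x A r : ℝ)) =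
      ∑ p ∈ A.sigma fun i => (Finset.univ : Finset (Fin (m i))),
        fun ω => (Metric.closedBall x r).indicator (1 : EuclideanSpace ℝ (Fin d) → ℝ) (X p.1 p.2 ω) := by
    ext ω
    rw [ballCount_eq_sum_indicator, Finset.sum_apply]
  have hind : iIndepFun (fun (p : (i : Fin J) × Fin (m i)) ω => (Metric.closedBall x r).indicator
      (1 : EuclideanSpace ℝ (Fin d) → ℝ) (X p.1 p.2 ω)) μ := hX.indep.comp (fun _ => (Metric.closedBall x r).indicator (1 : EuclideanSpace ℝ (Fin d) → ℝ))
    (fun _ => hmeas)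
  rw [hsum, iIndepFun.mgf_sum₀ hind (fun p => hmeas.comp_aemeasurable
    (hX.law p.1 p.2).aemeasurable)]
  have hmean : (Real.exp s - 1) * meanCount ν m x A r =
      ∑ p ∈ A.sigma fun i => (Finset.univ : Finset (Fin (m i))),
        (Real.exp s - 1) * (ν p.1).real (Metric.closedBall x r) := by
    rw [meanCount, Finset.mul_sum, Finset.sum_sigma]
    refine Finset.sum_congr rfl fun i _ => ?_
    simp only [Finset.sum_const, Finset.card_univ, Fintype.card_fin, nsmul_eq_mul]
    ring
  rw [hmean, Real.exp_sum]
  refine Finset.prod_le_prod (fun p _ => mgf_nonneg) fun p _ => ?_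
  refine (mgf_indicator_comp (hX.law p.1 p.2) measurableSet_closedBall s).trans_le ?_
  linarith [Real.add_one_le_exp ((Real.exp s - 1) * (ν p.1).real (Metric.closedBall x r))]

theorem integrable_exp_mul_ballCount [IsProbabilityMeasure μ]
    (hX : IsIndepSample μ ν m X)
    (x : EuclideanSpace ℝ (Fin d)) (A : Finset (Fin J)) (r s : ℝ) :
    Integrable (fun ω => Real.exp (s * (ballCount (fun i j => X i j ω) x A r : ℝ))) μ := by
  refine Integrable.of_bound (C := Real.exp (|s| * groupSize m A))
    (((aemeasurable_ballCount hX x A r).const_mul s).exp.aestronglyMeasurable)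
    (ae_of_all _ fun ω => ?_)
  rw [Real.norm_of_nonneg (Real.exp_pos _).le]
  refine Real.exp_le_exp.2 ?_
  have h : (ballCount (fun i j => X i j ω) x A r : ℝ) ≤ groupSize m A := by
    unfold ballCount groupSize
    exact_mod_cast Finset.sum_le_sum fun i _ => (Finset.card_le_univ _).trans (by simp)
  exact mul_le_mul (le_abs_self s) h (Nat.cast_nonneg _) (abs_nonneg s)

theorem hasDerivAt_poissonTilt (M a : ℝ) :
    HasDerivAt (fun s => (Real.exp s - 1) * M - a * s) (M - a) 0 := by
  have h2 : HasDerivAt (fun s : ℝ => Real.exp s) 1 0 := by simpa using Real.hasDerivAt_exp 0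
  exact (((h2.sub_const 1).mul_const M).sub ((hasDerivAt_id (0 : ℝ)).const_mul a)).congr_deriv
    (by simp)

/-- The exponent `(exp s - 1) * M - a * s` vanishes at `0` with slope `M - a < 0`. Choosing `s` from
`M` and `a` alone makes `c` independent of the sample, the radius and `k`, which the later union
bound requires. -/
theorem exists_measure_le_ballCount_le {M a : ℝ} (hMa : M < a) : ∃ c > 0,
    ∀ {d J : ℕ} {Ω : Type*} [MeasurableSpace Ω] {μ : Measure Ω} [IsProbabilityMeasure μ]
      {ν : Fin J → Measure (EuclideanSpace ℝ (Fin d))} {m : Fin J → ℕ}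
      {X : (i : Fin J) → Fin (m i) → Ω → EuclideanSpace ℝ (Fin d)}, IsIndepSample μ ν m X →
    ∀ (x : EuclideanSpace ℝ (Fin d)) (A : Finset (Fin J)) (r : ℝ) (k : ℕ),
      meanCount ν m x A r ≤ M * k →
      μ.real {ω | a * k ≤ ballCount (fun i j => X i j ω) x A r} ≤ Real.exp (-(c * k)) := by
  obtain ⟨s, hs, h⟩ := (exists_lt_of_hasDerivAt_ne_zero (hasDerivAt_poissonTilt M a)).1
    (by linarith)
  simp only [Real.exp_zero, sub_self, zero_mul, mul_zero] at h
  refine ⟨-((Real.exp s - 1) * M - a * s), by linarith, ?_⟩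
  intro d J Ω _ μ _ ν m X hX x A r k hM
  refine (measure_ge_le_exp_mul_mgf _ hs.le (integrable_exp_mul_ballCount hX x A r s)).trans ?_
  refine (mul_le_mul_of_nonneg_left (mgf_ballCount_le hX x A r s) (Real.exp_pos _).le).trans ?_
  rw [← Real.exp_add]
  refine Real.exp_le_exp.2 ?_
  have : 0 ≤ Real.exp s - 1 := by linarith [Real.one_le_exp hs.le]
  nlinarith

theorem exists_measure_ballCount_le_le {M a : ℝ} (hMa : a < M) : ∃ c > 0,
    ∀ {d J : ℕ} {Ω : Type*} [MeasurableSpace Ω] {μ : Measure Ω} [IsProbabilityMeasure μ]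
      {ν : Fin J → Measure (EuclideanSpace ℝ (Fin d))} {m : Fin J → ℕ}
      {X : (i : Fin J) → Fin (m i) → Ω → EuclideanSpace ℝ (Fin d)}, IsIndepSample μ ν m X →
    ∀ (x : EuclideanSpace ℝ (Fin d)) (A : Finset (Fin J)) (r : ℝ) (k : ℕ),
      M * k ≤ meanCount ν m x A r →
      μ.real {ω | ballCount (fun i j => X i j ω) x A r ≤ a * k} ≤ Real.exp (-(c * k)) := by
  obtain ⟨s, hs, h⟩ := (exists_lt_of_hasDerivAt_ne_zero (hasDerivAt_poissonTilt M a)).2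
    (by linarith)
  simp only [Real.exp_zero, sub_self, zero_mul, mul_zero] at h
  refine ⟨-((Real.exp s - 1) * M - a * s), by linarith, ?_⟩
  intro d J Ω _ μ _ ν m X hX x A r k hM
  refine (measure_le_le_exp_mul_mgf _ hs.le (integrable_exp_mul_ballCount hX x A r s)).trans ?_
  refine (mul_le_mul_of_nonneg_left (mgf_ballCount_le hX x A r s) (Real.exp_pos _).le).trans ?_
  rw [← Real.exp_add]
  refine Real.exp_le_exp.2 ?_
  have : Real.exp s - 1 ≤ 0 := by linarith [Real.exp_le_one_iff.2 hs.le]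
  nlinarith

/-! ### Neighbour counts -/

variable (T : TrainingSet d J m) (x : EuclideanSpace ℝ (Fin d)) (A B : Finset (Fin J))

theorem ballCount_mono {r r' : ℝ} (h : r ≤ r') : ballCount T x A r ≤ ballCount T x A r' :=
  Finset.sum_le_sum fun _ _ => Finset.card_le_card
    (Finset.monotone_filter_right _ fun _ _ hj => le_trans hj h)

theorem exists_ballCount_eq_groupSize : ∃ r, ballCount T x A r = groupSize m A := by
  obtain ⟨r, hr⟩ := (Set.finite_range
    fun p : (i : Fin J) × Fin (m i) => dist (T p.1 p.2) x).bddAbove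
  refine ⟨r, Finset.sum_congr rfl fun i _ => ?_⟩
  rw [Finset.filter_true_of_mem fun j _ => hr ⟨⟨i, j⟩, rfl⟩, Finset.card_univ, Fintype.card_fin]

/-- The bound on `k` makes the set under `sInf` nonempty; otherwise the infimum would take the
default value `0`. -/
theorem exists_neighborsNeeded_eq {k : ℕ} (hk : k ≤ groupSize m B) :
    ∃ r, k ≤ ballCount T x B r ∧
      neighborsNeeded T x A B k = ballCount T x A r + ballCount T x B r := by
  obtain ⟨r, hr⟩ := exists_ballCount_eq_groupSize T x B
  exact Nat.sInf_mem (s := {t : ℕ | ∃ r : ℝ, k ≤ ballCount T x B r ∧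
    t = ballCount T x A r + ballCount T x B r}) ⟨_, r, hr ▸ hk, rfl⟩

variable {A B}

theorem neighborsNeeded_le {k : ℕ} {r : ℝ} (hr : k ≤ ballCount T x B r) :
    neighborsNeeded T x A B k ≤ ballCount T x A r + ballCount T x B r :=
  Nat.sInf_le ⟨r, hr, rfl⟩

theorem le_neighborsNeeded {k : ℕ} (hk : k ≤ groupSize m B) {r : ℝ}
    (hr : ballCount T x B r < k) :
    ballCount T x A r + k ≤ neighborsNeeded T x A B k := by
  obtain ⟨r', hr', h⟩ := exists_neighborsNeeded_eq T x A B hk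
  rw [h]
  have : r ≤ r' := by
    by_contra! hlt
    have := ballCount_mono T x B hlt.le
    omega
  have := ballCount_mono T x A this
  omega

theorem self_le_neighborsNeeded {k : ℕ} (hk : k ≤ groupSize m B) :
    k ≤ neighborsNeeded T x A B k := by
  obtain ⟨r', hr', h⟩ := exists_neighborsNeeded_eq T x A B hk
  omega

theorem neighborsNeeded_mono {k k' : ℕ} (hk : k ≤ k') (hk' : k' ≤ groupSize m B) :
    neighborsNeeded T x A B k ≤ neighborsNeeded T x A B k' := by
  obtain ⟨r', hr', h⟩ := exists_neighborsNeeded_eq T x A B hk'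
  rw [h]
  exact neighborsNeeded_le T x (hk.trans hr')

/-! ### Evidence -/

/-- The level `1 - δ` separates the two evidences: a single small `e_k` lifts that of `B` above it,
and that of `A` never exceeds it. The bound `δ ≤ 1 / 2` covers the starting value of the running
maximum. -/
theorem minorityWins_of_ePValue {K k : ℕ} {δ : ℝ} (hδ : δ ≤ 1 / 2) (hk : 1 ≤ k)
    (hkK : k ≤ min K (groupSize m B)) (hek : ePValue T x A B k < δ)
    (h : ∀ l, 1 ≤ l → l ≤ min K (groupSize m B) → ePValue T x A B l ≤ 1 - δ) :
    MinorityWins T x A B K := by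
  have h1 : evidenceMajority T x A B K ≤ 1 - δ :=
    Finset.fold_max_le _ |>.2 ⟨by linarith, fun l hl =>
      h l (Finset.mem_Icc.1 hl).1 (Finset.mem_Icc.1 hl).2⟩
  have h2 : (Finset.Icc 1 (min K (groupSize m B))).fold min (1 / 2) (ePValue T x A B) ≤
      ePValue T x A B k :=
    Finset.fold_min_le _ |>.2 (Or.inr ⟨k, Finset.mem_Icc.2 ⟨hk, hkK⟩, le_rfl⟩)
  unfold MinorityWins evidenceMinority
  linarith

theorem not_minorityWins_of_ePValue {K k : ℕ} {δ : ℝ} (hδ : δ ≤ 1 / 2) (hk : 1 ≤ k)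
    (hkK : k ≤ min K (groupSize m B)) (hek : 1 - δ ≤ ePValue T x A B k)
    (h : ∀ l, 1 ≤ l → l ≤ min K (groupSize m B) → δ ≤ ePValue T x A B l) :
    ¬ MinorityWins T x A B K := by
  have h1 : δ ≤ (Finset.Icc 1 (min K (groupSize m B))).fold min (1 / 2) (ePValue T x A B) :=
    Finset.le_fold_min _ |>.2 ⟨hδ, fun l hl =>
      h l (Finset.mem_Icc.1 hl).1 (Finset.mem_Icc.1 hl).2⟩
  have h2 : ePValue T x A B k ≤ evidenceMajority T x A B K :=
    Finset.le_fold_max _ |>.2 (Or.inr ⟨k, Finset.mem_Icc.2 ⟨hk, hkK⟩, le_rfl⟩)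
  unfold MinorityWins evidenceMinority
  linarith

end

section

/-! ### Asymptotics of the binary classifier -/

/-- Independent training sets with continuous class densities `f i`, in which the share of class
`i` in the sample tends to `π i`. -/
structure IsSamplingScheme {d J : ℕ} {Ω : Type*} [MeasurableSpace Ω] (μ : Measure Ω)
    (f : Fin J → EuclideanSpace ℝ (Fin d) → ℝ) (m : ℕ → Fin J → ℕ) (π : Fin J → ℝ)
    (X : (n : ℕ) → (i : Fin J) → Fin (m n i) → Ω → EuclideanSpace ℝ (Fin d)) : Prop where
  continuous : ∀ i, Continuous (f i)
  nonneg : ∀ i y, 0 ≤ f i y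
  share_pos : ∀ i, 0 < π i
  tendsto_share : ∀ i, Tendsto (fun n : ℕ => (m n i : ℝ) / (n : ℝ)) atTop (𝓝 (π i))
  sample : ∀ n, IsIndepSample μ
    (fun i => (volume : Measure (EuclideanSpace ℝ (Fin d))).withDensity
      fun y => ENNReal.ofReal (f i y)) (m n) (X n)

/-- Density at `x` of the observations from the classes in `A`, relative to the whole sample. -/
noncomputable def groupDensity {d J : ℕ} (f : Fin J → EuclideanSpace ℝ (Fin d) → ℝ)
    (π : Fin J → ℝ) (x : EuclideanSpace ℝ (Fin d)) (A : Finset (Fin J)) : ℝ :=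
  ∑ i ∈ A, π i * f i x

variable {d J : ℕ} {Ω : Type*} [MeasurableSpace Ω] {μ : Measure Ω}
  {f : Fin J → EuclideanSpace ℝ (Fin d) → ℝ} {m : ℕ → Fin J → ℕ} {π : Fin J → ℝ}
  {X : (n : ℕ) → (i : Fin J) → Fin (m n i) → Ω → EuclideanSpace ℝ (Fin d)}

namespace IsSamplingScheme

theorem groupDensity_nonneg (h : IsSamplingScheme μ f m π X) (x : EuclideanSpace ℝ (Fin d))
    (A : Finset (Fin J)) : 0 ≤ groupDensity f π x A :=
  Finset.sum_nonneg fun i _ => mul_nonneg (h.share_pos i).le (h.nonneg i x)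

theorem sum_share_pos (h : IsSamplingScheme μ f m π X) {A : Finset (Fin J)} (hA : A.Nonempty) :
    0 < ∑ i ∈ A, π i :=
  Finset.sum_pos (fun i _ => h.share_pos i) hA

theorem tendsto_groupSize_div (h : IsSamplingScheme μ f m π X) (A : Finset (Fin J)) :
    Tendsto (fun n : ℕ => (groupSize (m n) A : ℝ) / n) atTop (𝓝 (∑ i ∈ A, π i)) := by
  have := tendsto_finsetSum A fun i _ => h.tendsto_share i
  refine this.congr fun n => ?_
  rw [groupSize, Nat.cast_sum, Finset.sum_div]

theorem tendsto_minorityShare (h : IsSamplingScheme μ f m π X) {A B : Finset (Fin J)}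
    (hA : A.Nonempty) (hB : B.Nonempty) :
    Tendsto (fun n => (groupSize (m n) B : ℝ) / ((groupSize (m n) A : ℝ) + groupSize (m n) B))
      atTop (𝓝 ((∑ i ∈ B, π i) / ((∑ i ∈ A, π i) + ∑ i ∈ B, π i))) := by
  have hwA := h.sum_share_pos hA
  have hwB := h.sum_share_pos hB
  refine ((h.tendsto_groupSize_div B).div ((h.tendsto_groupSize_div A).add
    (h.tendsto_groupSize_div B)) (by positivity)).congr' ?_
  filter_upwards [eventually_gt_atTop 0] with n hn
  have : (n : ℝ) ≠ 0 := by positivity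
  rw [Pi.div_apply, ← add_div, div_div_div_cancel_right₀ this]

theorem eventually_le_groupSize (h : IsSamplingScheme μ f m π X) {B : Finset (Fin J)}
    (hB : B.Nonempty) : ∃ κ > (0 : ℝ), ∀ᶠ n : ℕ in atTop, ∀ k : ℕ, k ≤ κ * n →
      k ≤ groupSize (m n) B := by
  have hwB := h.sum_share_pos hB
  refine ⟨(∑ i ∈ B, π i) / 2, by positivity, ?_⟩
  filter_upwards [(h.tendsto_groupSize_div B).eventually (lt_mem_nhds (half_lt_self hwB)),
    eventually_gt_atTop 0] with n hn hn0 k hk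
  have hn0 : (0 : ℝ) < n := by positivity
  rw [lt_div_iff₀ hn0] at hn
  exact_mod_cast hk.trans hn.le

/-- The ball is the one of volume `a * k / n`, in which class `i` has about `n * π i * f i x * (a *
k / n)` observations. -/
theorem exists_radius (h : IsSamplingScheme μ f m π X) (hd : 0 < d)
    (x : EuclideanSpace ℝ (Fin d)) {a ε : ℝ} (ha : 0 < a) (hε : 0 < ε) :
    ∃ κ > (0 : ℝ), ∀ᶠ n : ℕ in atTop, ∀ k : ℕ, 1 ≤ k → k ≤ κ * n → ∃ r, ∀ A : Finset (Fin J),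
      |meanCount (fun i => (volume : Measure (EuclideanSpace ℝ (Fin d))).withDensity
        fun y => ENNReal.ofReal (f i y)) (m n) x A r - a * groupDensity f π x A * k| ≤ ε * k := by
  have hterm : ∀ i, 0 ≤ f i x + (π i + 1) := fun i => by
    linarith [h.nonneg i x, h.share_pos i]
  -- Each class contributes a relative error `η` from its density and one from its share, weighted
  -- by at most `π i + 1` and by `f i x`. The final `+ 1` keeps `F` positive.
  set F : ℝ := ∑ i, (f i x + (π i + 1)) + 1 with hF
  have hF0 : 0 < F := by
    have : 0 ≤ ∑ i, (f i x + (π i + 1)) := Finset.sum_nonneg fun i _ => hterm i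
    linarith
  set η : ℝ := ε / (a * F) with hη
  have hη0 : 0 < η := by positivity
  obtain ⟨v₀, hv₀, hball⟩ := exists_closedBall_withDensity_sub_le hd h.continuous h.nonneg x hη0
  have hev : ∀ᶠ n : ℕ in atTop, ∀ i, |(m n i : ℝ) / n - π i| < min η 1 := by
    rw [eventually_all]
    exact fun i => Metric.tendsto_nhds.1 (h.tendsto_share i) _ (by positivity)
  refine ⟨v₀ / (2 * a), by positivity, ?_⟩
  filter_upwards [hev, eventually_gt_atTop 0] with n hn hn0 k hk hkn
  have hn0 : (0 : ℝ) < n := by positivity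
  have hk0 : (0 : ℝ) < k := by positivity
  obtain ⟨r, hr⟩ := hball (a * k / n) (by positivity) (by
    rw [div_lt_iff₀ hn0]
    calc a * k ≤ a * (v₀ / (2 * a) * n) := by gcongr
      _ = v₀ * n / 2 := by field_simp
      _ < v₀ * n := half_lt_self (by positivity))
  refine ⟨r, fun A => ?_⟩
  have hcl : ∀ i, |(m n i : ℝ) * ((volume : Measure (EuclideanSpace ℝ (Fin d))).withDensity
        fun y => ENNReal.ofReal (f i y)).real (Metric.closedBall x r) - a * (π i * f i x) * k| ≤
      a * k * η * (f i x + (π i + 1)) := by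
    intro i
    set P := ((volume : Measure (EuclideanSpace ℝ (Fin d))).withDensity
        fun y => ENNReal.ofReal (f i y)).real (Metric.closedBall x r)
    set q : ℝ := (m n i : ℝ) / n with hq
    have hmq : (m n i : ℝ) = q * n := by rw [hq]; field_simp
    have hq0 : 0 ≤ q := by positivity
    have h1 := lt_min_iff.1 (hn i)
    have hq1 : q ≤ π i + 1 := by linarith [(abs_lt.1 h1.2).2]
    have hsplit : (m n i : ℝ) * P - a * (π i * f i x) * k =
        q * n * (P - f i x * (a * k / n)) + a * k * f i x * (q - π i) := by
      rw [hmq]; field_simp; ring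
    rw [hsplit]
    refine (abs_add_le _ _).trans ?_
    have hfx := h.nonneg i x
    rw [abs_mul, abs_mul (a * k * f i x), abs_of_nonneg (by positivity : 0 ≤ q * n),
      abs_of_nonneg (by positivity : 0 ≤ a * k * f i x)]
    calc q * n * |P - f i x * (a * k / n)| + a * k * f i x * |q - π i|
        ≤ q * n * (η * (a * k / n)) + a * k * f i x * η := by
          gcongr
          · exact hr i
          · exact h1.1.le
      _ = a * k * η * (f i x + q) := by field_simp; ring
      _ ≤ _ := by gcongr
  rw [meanCount, groupDensity, Finset.mul_sum, Finset.sum_mul, ← Finset.sum_sub_distrib]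
  calc |∑ i ∈ A, _| ≤ ∑ i ∈ A, a * k * η * (f i x + (π i + 1)) :=
        (Finset.abs_sum_le_sum_abs _ _).trans (Finset.sum_le_sum fun i _ => hcl i)
    _ ≤ ∑ i, a * k * η * (f i x + (π i + 1)) :=
        Finset.sum_le_sum_of_subset_of_nonneg (Finset.subset_univ _) fun i _ _ =>
          mul_nonneg (by positivity) (hterm i)
    _ = a * k * η * (F - 1) := by rw [← Finset.mul_sum, hF]; ring
    _ ≤ a * k * η * F := by gcongr; linarith
    _ = ε * k := by rw [hη]; field_simp

variable [IsProbabilityMeasure μ]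

theorem exists_measure_neighborsNeeded_lt_le (h : IsSamplingScheme μ f m π X) (hd : 0 < d)
    (x : EuclideanSpace ℝ (Fin d)) {A B : Finset (Fin J)} (hA : A.Nonempty) (hB : B.Nonempty)
    (hlt : (∑ i ∈ A, π i) * groupDensity f π x B < (∑ i ∈ B, π i) * groupDensity f π x A) :
    ∃ C > 1 + (∑ i ∈ A, π i) / ∑ i ∈ B, π i, ∃ c > 0, ∃ κ > (0 : ℝ), ∀ᶠ n : ℕ in atTop,
      ∀ k : ℕ, 1 ≤ k → k ≤ κ * n →
      μ.real {ω | neighborsNeeded (fun i j => X n i j ω) x A B k < C * k} ≤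
        2 * Real.exp (-(c * k)) := by
  have hwA := h.sum_share_pos hA
  have hwB := h.sum_share_pos hB
  have hbA := h.groupDensity_nonneg x A
  have hbB := h.groupDensity_nonneg x B
  set wA := ∑ i ∈ A, π i
  set wB := ∑ i ∈ B, π i
  set bA := groupDensity f π x A
  set bB := groupDensity f π x B
  -- In the ball of volume `k / (u * n)` the expected count from `B` stays below `k`, while that
  -- from `A` exceeds `(wA / wB) * k`. The strict gaps left by `θ`, `MA`, `MB` absorb the
  -- approximation error and the fluctuations.
  obtain ⟨u, hu1, hu2⟩ := exists_between (show bB < wB * bA / wA by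
    rw [lt_div_iff₀ hwA]; linarith)
  have hu : 0 < u := hbB.trans_lt hu1
  have h1 : u⁻¹ * bB < 1 := by rw [inv_mul_lt_iff₀ hu]; linarith
  have h2 : wA / wB < u⁻¹ * bA := by
    rw [lt_div_iff₀ hwA] at hu2
    rw [lt_inv_mul_iff₀ hu, mul_div_assoc', div_lt_iff₀ hwB]; linarith
  obtain ⟨θ, hθ1, hθ2⟩ := exists_between h2
  obtain ⟨MA, hMA1, hMA2⟩ := exists_between hθ2
  obtain ⟨MB, hMB1, hMB2⟩ := exists_between h1
  obtain ⟨c₁, hc₁, hcA⟩ := exists_measure_ballCount_le_le hMA1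
  obtain ⟨c₂, hc₂, hcB⟩ := exists_measure_le_ballCount_le hMB2
  obtain ⟨κ₁, hκ₁, hr⟩ := h.exists_radius hd x (inv_pos.2 hu)
    (lt_min (sub_pos.2 hMA2) (sub_pos.2 hMB1))
  obtain ⟨κ₂, hκ₂, hs⟩ := h.eventually_le_groupSize hB
  refine ⟨1 + θ, by linarith, min c₁ c₂, lt_min hc₁ hc₂, min κ₁ κ₂, lt_min hκ₁ hκ₂, ?_⟩
  filter_upwards [hr, hs] with n hr hs k hk hkn
  obtain ⟨r, hr⟩ := hr k hk (hkn.trans (by gcongr; exact min_le_left _ _))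
  have hs := hs k (hkn.trans (by gcongr; exact min_le_right _ _))
  have hrA := (abs_le.1 (hr A)).1
  have hrB := (abs_le.1 (hr B)).2
  have hk0 : (0 : ℝ) ≤ k := Nat.cast_nonneg k
  have eA := hcA (h.sample n) x A r k (by
    have := mul_le_mul_of_nonneg_right (min_le_left (u⁻¹ * bA - MA) (MB - u⁻¹ * bB)) hk0
    linarith)
  have eB := hcB (h.sample n) x B r k (by
    have := mul_le_mul_of_nonneg_right (min_le_right (u⁻¹ * bA - MA) (MB - u⁻¹ * bB)) hk0
    linarith)
  calc _ ≤ μ.real ({ω | ballCount (fun i j => X n i j ω) x A r ≤ θ * k} ∪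
          {ω | (1 : ℝ) * k ≤ ballCount (fun i j => X n i j ω) x B r}) := by
        refine measureReal_mono fun ω hω => ?_
        by_contra! hcon
        simp only [Set.mem_union, Set.mem_ofPred_eq, not_or, not_le, one_mul] at hcon hω
        have := le_neighborsNeeded (fun i j => X n i j ω) x (A := A) hs
          (by exact_mod_cast hcon.2)
        have : (ballCount (fun i j => X n i j ω) x A r : ℝ) + k ≤
          neighborsNeeded (fun i j => X n i j ω) x A B k := by exact_mod_cast this
        linarith [hcon.1]
    _ ≤ _ := measureReal_union_le _ _
    _ ≤ Real.exp (-(c₁ * k)) + Real.exp (-(c₂ * k)) := add_le_add eA eB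
    _ ≤ Real.exp (-(min c₁ c₂ * k)) + Real.exp (-(min c₁ c₂ * k)) := by
        gcongr
        · exact min_le_left _ _
        · exact min_le_right _ _
    _ = _ := by ring

theorem exists_measure_lt_neighborsNeeded_le (h : IsSamplingScheme μ f m π X) (hd : 0 < d)
    (x : EuclideanSpace ℝ (Fin d)) {A B : Finset (Fin J)} (hA : A.Nonempty) (hB : B.Nonempty)
    (hAB : Disjoint A B)
    (hlt : (∑ i ∈ B, π i) * groupDensity f π x A < (∑ i ∈ A, π i) * groupDensity f π x B) :
    ∃ C < 1 + (∑ i ∈ A, π i) / ∑ i ∈ B, π i, 0 < C ∧ ∃ c > 0, ∃ κ > (0 : ℝ), ∀ᶠ n : ℕ in atTop,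
      ∀ k : ℕ, 1 ≤ k → k ≤ κ * n →
      μ.real {ω | C * k < neighborsNeeded (fun i j => X n i j ω) x A B k} ≤
        2 * Real.exp (-(c * k)) := by
  have hwA := h.sum_share_pos hA
  have hwB := h.sum_share_pos hB
  have hbA := h.groupDensity_nonneg x A
  have hbB := h.groupDensity_nonneg x B
  have hbAB : groupDensity f π x (A ∪ B) = groupDensity f π x A + groupDensity f π x B :=
    Finset.sum_union hAB
  set wA := ∑ i ∈ A, π i
  set wB := ∑ i ∈ B, π i
  set bA := groupDensity f π x A
  set bB := groupDensity f π x B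
  -- Now the ball of volume `k / (u * n)` is expected to hold more than `k` observations from `B`,
  -- but fewer than `(1 + wA / wB) * k` in all.
  obtain ⟨u, hu1, hu2⟩ := exists_between (show (bA + bB) * wB / (wA + wB) < bB by
    rw [div_lt_iff₀ (by positivity)]; nlinarith)
  have hu : 0 < u := lt_of_le_of_lt (by positivity) hu1
  have h1 : 1 < u⁻¹ * bB := by rw [lt_inv_mul_iff₀ hu]; linarith
  have h2 : u⁻¹ * (bA + bB) < 1 + wA / wB := by
    rw [div_lt_iff₀ (by positivity)] at hu1
    have : 1 + wA / wB = (wA + wB) / wB := by field_simp; ring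
    rw [inv_mul_lt_iff₀ hu, this, mul_div_assoc', lt_div_iff₀ hwB]; linarith
  have h3 : 0 ≤ u⁻¹ * (bA + bB) := by positivity
  obtain ⟨C, hC1, hC2⟩ := exists_between h2
  obtain ⟨M, hM1, hM2⟩ := exists_between hC1
  obtain ⟨MB, hMB1, hMB2⟩ := exists_between h1
  obtain ⟨c₁, hc₁, hcA⟩ := exists_measure_le_ballCount_le hM2
  obtain ⟨c₂, hc₂, hcB⟩ := exists_measure_ballCount_le_le hMB1
  obtain ⟨κ₁, hκ₁, hr⟩ := h.exists_radius hd x (inv_pos.2 hu)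
    (lt_min (sub_pos.2 hM1) (sub_pos.2 hMB2))
  refine ⟨C, hC2, by linarith, min c₁ c₂, lt_min hc₁ hc₂, κ₁, hκ₁, ?_⟩
  filter_upwards [hr] with n hr k hk hkn
  obtain ⟨r, hr⟩ := hr k hk hkn
  have hrA := (abs_le.1 (hr (A ∪ B))).2
  have hrB := (abs_le.1 (hr B)).1
  rw [hbAB] at hrA
  have hk0 : (0 : ℝ) ≤ k := Nat.cast_nonneg k
  have eA := hcA (h.sample n) x (A ∪ B) r k (by
    have := mul_le_mul_of_nonneg_right (min_le_left (M - u⁻¹ * (bA + bB)) (u⁻¹ * bB - MB)) hk0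
    linarith)
  have eB := hcB (h.sample n) x B r k (by
    have := mul_le_mul_of_nonneg_right (min_le_right (M - u⁻¹ * (bA + bB)) (u⁻¹ * bB - MB)) hk0
    linarith)
  calc _ ≤ μ.real ({ω | C * k ≤ ballCount (fun i j => X n i j ω) x (A ∪ B) r} ∪
          {ω | ballCount (fun i j => X n i j ω) x B r ≤ (1 : ℝ) * k}) := by
        refine measureReal_mono fun ω hω => ?_
        by_contra! hcon
        simp only [Set.mem_union, Set.mem_ofPred_eq, not_or, not_le, one_mul] at hcon hω
        have h4 := neighborsNeeded_le (fun i j => X n i j ω) x (A := A) (B := B) (r := r) (k := k)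
          (by exact_mod_cast hcon.2.le)
        have h5 : ballCount (fun i j => X n i j ω) x (A ∪ B) r =
          ballCount (fun i j => X n i j ω) x A r + ballCount (fun i j => X n i j ω) x B r :=
          Finset.sum_union hAB
        rw [← h5] at h4
        have : (neighborsNeeded (fun i j => X n i j ω) x A B k : ℝ) ≤
          ballCount (fun i j => X n i j ω) x (A ∪ B) r := by exact_mod_cast h4
        linarith [hcon.1]
    _ ≤ _ := measureReal_union_le _ _
    _ ≤ Real.exp (-(c₁ * k)) + Real.exp (-(c₂ * k)) := add_le_add eA eB
    _ ≤ Real.exp (-(min c₁ c₂ * k)) + Real.exp (-(min c₁ c₂ * k)) := by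
        gcongr
        · exact min_le_left _ _
        · exact min_le_right _ _
    _ = _ := by ring

end IsSamplingScheme

theorem eventually_le_mul_of_tendsto_div {K : ℕ → ℕ}
    (hK : Tendsto (fun n : ℕ => (K n : ℝ) / n) atTop (𝓝 0)) {κ : ℝ} (hκ : 0 < κ) :
    ∀ᶠ n : ℕ in atTop, (K n : ℝ) ≤ κ * n := by
  filter_upwards [hK.eventually (gt_mem_nhds hκ), eventually_gt_atTop 0] with n hn hn0
  have hn0 : (0 : ℝ) < n := by positivity
  exact ((div_lt_iff₀ hn0).1 hn).le

/-- Union bound over all large `k ≤ K n` for events with exponentially small probabilities. -/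
theorem eventually_measure_biUnion_le [IsProbabilityMeasure μ] {E : ℕ → ℕ → Set Ω} {c κ : ℝ}
    (hc : 0 < c) (hκ : 0 < κ)
    (hE : ∀ᶠ n : ℕ in atTop, ∀ k : ℕ, 1 ≤ k → k ≤ κ * n →
      μ.real (E n k) ≤ 2 * Real.exp (-(c * k)))
    {K : ℕ → ℕ} (hK : Tendsto (fun n : ℕ => (K n : ℝ) / n) atTop (𝓝 0)) {η : ℝ} (hη : 0 < η) :
    ∀ᶠ k₀ in atTop, ∀ᶠ n : ℕ in atTop, μ.real (⋃ k ∈ Finset.Icc k₀ (K n), E n k) < η := by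
  have hsum : Summable fun k : ℕ => 2 * Real.exp (-(c * k)) := by
    have := (summable_geometric_of_lt_one (Real.exp_pos (-c)).le
      (Real.exp_lt_one_iff.2 (by linarith))).mul_left 2
    refine this.congr fun k => ?_
    rw [← Real.exp_nat_mul]; ring_nf
  obtain ⟨s, hs⟩ := summable_iff_vanishing_norm.1 hsum η hη
  filter_upwards [eventually_gt_atTop (s.sup id), eventually_ge_atTop 1] with k₀ hk₀ hk₁
  filter_upwards [hE, eventually_le_mul_of_tendsto_div hK hκ] with n hn hKn
  refine (measureReal_biUnion_finset_le _ _).trans_lt (lt_of_le_of_lt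
    (Finset.sum_le_sum fun k hk => hn k ?_ ?_) ((le_abs_self _).trans_lt
      (hs (Finset.Icc k₀ (K n)) ?_)))
  · exact hk₁.trans (Finset.mem_Icc.1 hk).1
  · exact le_trans (by exact_mod_cast (Finset.mem_Icc.1 hk).2) hKn
  · refine Finset.disjoint_left.2 fun k hk hks => ?_
    have : k ≤ s.sup id := Finset.le_sup (f := id) hks
    have := (Finset.mem_Icc.1 hk).1
    omega

end

/-! ### Consistency of the binary classifier. -/

section

variable {d J : ℕ} {Ω : Type*} [MeasurableSpace Ω] {μ : Measure Ω}
  {f : Fin J → EuclideanSpace ℝ (Fin d) → ℝ} {m : ℕ → Fin J → ℕ} {π : Fin J → ℝ}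
  {X : (n : ℕ) → (i : Fin J) → Fin (m n i) → Ω → EuclideanSpace ℝ (Fin d)}
  [IsProbabilityMeasure μ]

namespace IsSamplingScheme

theorem tendsto_measure_minorityWins (h : IsSamplingScheme μ f m π X) (hd : 0 < d)
    (x : EuclideanSpace ℝ (Fin d)) {A B : Finset (Fin J)} (hA : A.Nonempty) (hB : B.Nonempty)
    (hlt : (∑ i ∈ A, π i) * groupDensity f π x B < (∑ i ∈ B, π i) * groupDensity f π x A)
    {K : ℕ → ℕ} (hK : Tendsto K atTop atTop)
    (hKn : Tendsto (fun n : ℕ => (K n : ℝ) / n) atTop (𝓝 0)) :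
    Tendsto (fun n => μ.real {ω | MinorityWins (fun i j => X n i j ω) x A B (K n)})
      atTop (𝓝 0) := by
  have hwA := h.sum_share_pos hA
  have hwB := h.sum_share_pos hB
  have hshare := h.tendsto_minorityShare hA hB
  obtain ⟨C, hC, c, hc, κ, hκ, hE⟩ := h.exists_measure_neighborsNeeded_lt_le hd x hA hB hlt
  obtain ⟨κ', hκ', hs⟩ := h.eventually_le_groupSize hB
  set wA := ∑ i ∈ A, π i
  set wB := ∑ i ∈ B, π i
  set p := wB / (wA + wB) with hp
  have hp0 : 0 < p := by positivity
  have hp1 : p < 1 := by rw [hp, div_lt_one (by positivity)]; linarith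
  have hpC : 1 < p * C := by
    have : p * (1 + wA / wB) = 1 := by rw [hp]; field_simp; ring
    nlinarith
  obtain ⟨β, hβ0, hβ1, hβ⟩ := eventually_one_sub_adjustedPValue_le hp0 hp1 hpC
  have hβlim := tendsto_pow_atTop_nhds_zero_of_lt_one hβ0.le hβ1
  refine Metric.tendsto_nhds.2 fun η hη => ?_
  obtain ⟨k₀, hk₀, hβk₀⟩ := ((eventually_measure_biUnion_le hc hκ hE hKn hη).and
    (hβlim.eventually (gt_mem_nhds (show (0 : ℝ) < 1 / 2 by norm_num)))).exists
  -- Lower bound for `e_l` with `l < k₀`, valid once the sample share exceeds `p / 2`. For `l ≥ k₀`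
  -- the choice `β ^ k₀ < 1 / 2` gives `e_l > 1 / 2 ≥ δ`.
  set δ : ℝ := 1 / 2 * (p / 2) ^ k₀ with hδ
  have hδ0 : 0 < δ := by positivity
  have hδ1 : δ ≤ 1 / 2 := by
    have : (p / 2) ^ k₀ ≤ 1 := pow_le_one₀ (by positivity) (by linarith)
    linarith
  filter_upwards [hk₀, hshare.eventually hβ,
    hshare.eventually (lt_mem_nhds (half_lt_self hp0)), hshare.eventually (gt_mem_nhds hp1),
    hK.eventually_ge_atTop k₀, hK.eventually_ge_atTop 1,
    (hβlim.comp hK).eventually (gt_mem_nhds hδ0), hs,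
    eventually_le_mul_of_tendsto_div hKn hκ'] with n hn hβn hpl hpu hKk₀ hK1 hβK hs hKκ
  have hKB : min (K n) (groupSize (m n) B) = K n := min_eq_left (hs _ hKκ)
  rw [Real.dist_0_eq_abs, abs_of_nonneg measureReal_nonneg]
  refine (measureReal_mono (fun ω hω => ?_) (measure_ne_top _ _)).trans_lt hn
  by_contra hcon
  simp only [Set.mem_iUnion, Set.mem_ofPred_eq, not_exists, not_lt] at hcon
  have hek : ∀ l, 1 ≤ l → k₀ ≤ l → l ≤ K n →
      1 - β ^ l ≤ ePValue (fun i j => X n i j ω) x A B l := fun l hl1 hl hlK => by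
    have := hβn l _ hl1 (hcon l (Finset.mem_Icc.2 ⟨hl, hlK⟩))
    unfold ePValue
    linarith
  refine not_minorityWins_of_ePValue (fun i j => X n i j ω) x hδ1 hK1 hKB.ge ?_ ?_ hω
  · have h1 := hek (K n) hK1 hKk₀ le_rfl
    have h2 : β ^ K n < δ := hβK
    linarith
  · rw [hKB]
    intro l hl1 hlK
    rcases le_or_gt k₀ l with hl | hl
    · have h1 := hek l hl1 hl hlK
      have h2 := pow_le_pow_of_le_one hβ0.le hβ1.le hl
      linarith
    · refine le_trans ?_ (half_pow_le_adjustedPValue (by positivity) hpu.le hl1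
        (self_le_neighborsNeeded _ x (hlK.trans (hs _ hKκ))))
      rw [hδ]
      gcongr
      calc (p / 2) ^ k₀ ≤ (p / 2) ^ l :=
            pow_le_pow_of_le_one (by positivity) (by linarith) hl.le
        _ ≤ _ := by gcongr

theorem tendsto_measure_not_minorityWins (h : IsSamplingScheme μ f m π X) (hd : 0 < d)
    (x : EuclideanSpace ℝ (Fin d)) {A B : Finset (Fin J)} (hA : A.Nonempty) (hB : B.Nonempty)
    (hAB : Disjoint A B)
    (hlt : (∑ i ∈ B, π i) * groupDensity f π x A < (∑ i ∈ A, π i) * groupDensity f π x B)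
    {K : ℕ → ℕ} (hK : Tendsto K atTop atTop)
    (hKn : Tendsto (fun n : ℕ => (K n : ℝ) / n) atTop (𝓝 0)) :
    Tendsto (fun n => μ.real {ω | ¬ MinorityWins (fun i j => X n i j ω) x A B (K n)})
      atTop (𝓝 0) := by
  have hwA := h.sum_share_pos hA
  have hwB := h.sum_share_pos hB
  have hshare := h.tendsto_minorityShare hA hB
  obtain ⟨C, hC, hC0, c, hc, κ, hκ, hE⟩ :=
    h.exists_measure_lt_neighborsNeeded_le hd x hA hB hAB hlt
  obtain ⟨κ', hκ', hs⟩ := h.eventually_le_groupSize hB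
  set wA := ∑ i ∈ A, π i
  set wB := ∑ i ∈ B, π i
  set p := wB / (wA + wB) with hp
  have hp0 : 0 < p := by positivity
  have hp1 : p < 1 := by rw [hp, div_lt_one (by positivity)]; linarith
  have hpC : p * C < 1 := by
    have : p * (1 + wA / wB) = 1 := by rw [hp]; field_simp; ring
    nlinarith
  obtain ⟨β, hβ0, hβ1, hβ⟩ := eventually_adjustedPValue_le hp0 hp1 hpC
  have hβlim := tendsto_pow_atTop_nhds_zero_of_lt_one hβ0.le hβ1
  refine Metric.tendsto_nhds.2 fun η hη => ?_
  obtain ⟨k₀, hk₀, hβk₀⟩ := ((eventually_measure_biUnion_le hc hκ hE hKn hη).and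
    (hβlim.eventually (gt_mem_nhds (show (0 : ℝ) < 1 / 2 by norm_num)))).exists
  -- On the good event, monotonicity in `k` gives `N_l ≤ N_{k₀} ≤ ⌈C * k₀⌉` for `l < k₀`. The
  -- remaining summands ensure `N_l < M` and `l ≤ M`.
  set M : ℕ := ⌈C * k₀⌉₊ + k₀ + 1 with hM
  set δ : ℝ := (p / 2 * ((1 - p) / 2)) ^ M with hδ
  have hq0 : 0 < 1 - p := by linarith
  have hδ0 : 0 < δ := by positivity
  have hδ1 : δ ≤ 1 / 2 := by
    have h1 : p / 2 * ((1 - p) / 2) ≤ 1 / 2 := by nlinarith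
    have h2 := pow_le_pow_of_le_one (by positivity) (h1.trans (by norm_num))
      (show 1 ≤ M by omega)
    rw [pow_one] at h2
    exact h2.trans h1
  filter_upwards [hk₀, hshare.eventually hβ,
    hshare.eventually (lt_mem_nhds (half_lt_self hp0)),
    hshare.eventually (gt_mem_nhds (show p < 1 - (1 - p) / 2 by linarith)),
    hK.eventually_ge_atTop k₀, hK.eventually_ge_atTop 1,
    (hβlim.comp hK).eventually (gt_mem_nhds hδ0), hs,
    eventually_le_mul_of_tendsto_div hKn hκ'] with n hn hβn hpl hpu hKk₀ hK1 hβK hs hKκ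
  have hKB : min (K n) (groupSize (m n) B) = K n := min_eq_left (hs _ hKκ)
  rw [Real.dist_0_eq_abs, abs_of_nonneg measureReal_nonneg]
  refine (measureReal_mono (fun ω hω => ?_) (measure_ne_top _ _)).trans_lt hn
  by_contra hcon
  simp only [Set.mem_iUnion, Set.mem_ofPred_eq, not_exists, not_lt] at hcon
  have hek : ∀ l, 1 ≤ l → k₀ ≤ l → l ≤ K n →
      ePValue (fun i j => X n i j ω) x A B l ≤ β ^ l := fun l hl1 hl hlK =>
    hβn l _ hl1 (hcon l (Finset.mem_Icc.2 ⟨hl, hlK⟩))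
  refine hω (minorityWins_of_ePValue (fun i j => X n i j ω) x hδ1 hK1 hKB.ge ?_ ?_)
  · exact (hek (K n) hK1 hKk₀ le_rfl).trans_lt hβK
  · rw [hKB]
    intro l hl1 hlK
    rcases le_or_gt k₀ l with hl | hl
    · have h1 := hek l hl1 hl hlK
      have h2 := pow_le_pow_of_le_one hβ0.le hβ1.le hl
      linarith
    · have hN : neighborsNeeded (fun i j => X n i j ω) x A B l < M := by
        have h1 := neighborsNeeded_mono (fun i j => X n i j ω) x (A := A) (B := B) hl.le
          (hKk₀.trans (hs _ hKκ))
        have h2 : neighborsNeeded (fun i j => X n i j ω) x A B k₀ ≤ ⌈C * k₀⌉₊ := by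
          exact_mod_cast (hcon k₀ (Finset.mem_Icc.2 ⟨le_rfl, hKk₀⟩)).trans (Nat.le_ceil _)
        omega
      refine (adjustedPValue_le_one_sub (by linarith) (by linarith) hl1
        (show l ≤ M by omega) hN).trans ?_
      rw [hδ]
      gcongr
      linarith

end IsSamplingScheme

/-! ### Consistency of the multi-class rules -/

/-- Only subadditivity is used, so no measurability of the classification events is needed. -/
theorem tendsto_measure_one_of_compl_subset {ι : Type*} [Fintype ι] {G : ℕ → Set Ω}
    {W : ι → ℕ → Set Ω} (hW : ∀ i, Tendsto (fun n => μ.real (W i n)) atTop (𝓝 0))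
    (hG : ∀ n ω, (∀ i, ω ∉ W i n) → ω ∈ G n) :
    Tendsto (fun n => μ (G n)) atTop (𝓝 1) := by
  have hreal : Tendsto (fun n => μ.real (G n)) atTop (𝓝 1) := by
    have hsum : Tendsto (fun n => 1 - ∑ i, μ.real (W i n)) atTop (𝓝 1) := by
      simpa using (tendsto_finsetSum Finset.univ fun i _ => hW i).const_sub 1
    refine tendsto_of_tendsto_of_tendsto_of_le_of_le hsum tendsto_const_nhds (fun n => ?_)
      fun n => measureReal_le_one
    have h1 : μ.real Set.univ ≤ μ.real (G n ∪ ⋃ i, W i n) := measureReal_mono fun ω _ => by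
      by_cases h : ∀ i, ω ∉ W i n
      · exact Or.inl (hG n ω h)
      · push Not at h
        exact Or.inr (Set.mem_iUnion.2 h)
    have h2 := measureReal_union_le (μ := μ) (G n) (⋃ i, W i n)
    have h3 := measureReal_iUnion_fintype_le (μ := μ) fun i => W i n
    rw [probReal_univ] at h1
    show 1 - ∑ i, μ.real (W i n) ≤ μ.real (G n)
    linarith
  have := ENNReal.tendsto_ofReal hreal
  simpa using this

end

/-- Every class strictly better than the smallest class `c` survives and every strictly worse one is
dropped. So an empty winning set makes `c` optimal, and otherwise the best winner is optimal in `S`;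
classes equal to `c` may go either way. -/
theorem le_ovoPlusOn {d J : ℕ} {m : Fin J → ℕ} (tie : TieRule J) (K : Fin J → Fin J → ℕ)
    (T : TrainingSet d J m) (x : EuclideanSpace ℝ (Fin d)) (v : Fin J → ℝ)
    (h1 : ∀ j c, v c < v j → ¬ MinorityWins T x {j} {c} (K j c))
    (h2 : ∀ j c, v j < v c → MinorityWins T x {j} {c} (K j c))
    (S : Finset (Fin J)) (hS : S.Nonempty) :
    ovoPlusOn tie K T x S ∈ S ∧ ∀ j ∈ S, v j ≤ v (ovoPlusOn tie K T x S) := by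
  induction hN : S.card using Nat.strong_induction_on generalizing S with
  | _ N ih =>
  set c := smallestClass m tie S with hc
  have hcS : c ∈ S := smallestClass_mem m tie S hS
  have hmem : ∀ j, j ∈ ovoWinners tie K T x S ↔
      (j ≠ c ∧ j ∈ S) ∧ ¬ MinorityWins T x {j} {c} (K j c) := fun j => by
    simp [ovoWinners, ← hc]
  rw [ovoPlusOn]
  split_ifs with hW
  · refine ⟨hcS, fun j hj => ?_⟩
    by_contra! hlt
    have := (hmem j).2 ⟨⟨fun h => hlt.ne' (by rw [h]), hj⟩, h1 j c hlt⟩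
    simp [hW] at this
  · obtain ⟨ihm, ihv⟩ := ih _ (hN ▸ ovoWinners_card_lt tie K T x S hW) _
      (Finset.nonempty_iff_ne_empty.2 hW) rfl
    set w := ovoPlusOn tie K T x (ovoWinners tie K T x S)
    have hw := (hmem w).1 ihm
    have hcw : v c ≤ v w := by
      by_contra! hlt
      exact hw.2 (h2 w c hlt)
    refine ⟨hw.1.2, fun j hj => ?_⟩
    rcases le_or_gt (v j) (v c) with hle | hlt
    · exact hle.trans hcw
    · exact ihv j ((hmem j).2 ⟨⟨fun h => hlt.ne' (by rw [h]), hj⟩, h1 j c hlt⟩)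

/-- While the values on `S` are not all equal, each best class gets a vote, hence the maximum, and
each worst class gets none. So the best classes always survive, and a tie of all classes forces
equal values, where any choice by evidence is correct. -/
theorem le_ovrPlusOn {d J : ℕ} {m : Fin J → ℕ} (tie : TieRule J)
    (K : Finset (Fin J) → Fin J → ℕ) (T : TrainingSet d J m) (x : EuclideanSpace ℝ (Fin d))
    (v : Fin J → ℝ)
    (h1 : ∀ S, ∀ i ∈ S, (∀ j ∈ S, v j ≤ v i) → (∃ j ∈ S, v j < v i) →
      OvrWins tie (K S i) T x S i)
    (h2 : ∀ S, ∀ i ∈ S, (∀ j ∈ S, v i ≤ v j) → (∃ j ∈ S, v i < v j) →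
      ¬ OvrWins tie (K S i) T x S i)
    (S : Finset (Fin J)) (hS : S.Nonempty) :
    ovrPlusOn tie K T x S ∈ S ∧ ∀ j ∈ S, v j ≤ v (ovrPlusOn tie K T x S) := by
  induction hN : S.card using Nat.strong_induction_on generalizing S with
  | _ N ih =>
  obtain ⟨i, hi, hmax⟩ := S.exists_max_image v hS
  have hvotes : ∀ j, ovrVotes tie K T x S j ≤ 1 := fun j => by
    unfold ovrVotes; split_ifs <;> simp
  rw [ovrPlusOn]
  split_ifs with hL
  · have hpick : ovrByEvidence tie K T x S ∈ S := by
      obtain ⟨e, he, hemax⟩ :=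
        S.exists_max_image (fun i => ovrEvidence tie (K S i) T x S i) hS
      exact (Finset.mem_filter.1 (tie.pick_mem _ ⟨e, Finset.mem_filter.2 ⟨he, hemax⟩⟩)).1
    obtain ⟨l, hl, hmin⟩ := S.exists_min_image v hS
    have hil : v i ≤ v l := by
      by_contra! hlt
      rw [← hL] at hl
      have h3 := (Finset.mem_filter.1 hl).2 i hi
      rw [hL] at hl
      rw [ovrVotes, ovrVotes, if_pos (h1 S i hi hmax ⟨l, hl, hlt⟩),
        if_neg (h2 S l hl hmin ⟨i, hi, hlt⟩)] at h3
      omega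
    exact ⟨hpick, fun j hj => (hmax j hj).trans (hil.trans (hmin _ hpick))⟩
  · have hne : (ovrLeaders tie K T x S).Nonempty := by
      obtain ⟨e, he, hemax⟩ := S.exists_max_image (ovrVotes tie K T x S) hS
      exact ⟨e, Finset.mem_filter.2 ⟨he, hemax⟩⟩
    obtain ⟨ihm, ihv⟩ := ih _ (hN ▸ ovrLeaders_card_lt tie K T x S hL) _ hne rfl
    have hmS := (Finset.mem_filter.1 ihm).1
    refine ⟨hmS, fun j hj => (hmax j hj).trans ?_⟩
    by_contra! hlt
    refine hlt.not_ge (ihv i (Finset.mem_filter.2 ⟨hi, fun j _ => (hvotes j).trans ?_⟩))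
    rw [ovrVotes, if_pos (h1 S i hi hmax ⟨_, hmS, hlt⟩)]

/-! ### Consistency of OvO+ and OvR+. -/

section

variable {d J : ℕ} {Ω : Type*} [MeasurableSpace Ω] {μ : Measure Ω}
  {f : Fin J → EuclideanSpace ℝ (Fin d) → ℝ} {m : ℕ → Fin J → ℕ} {π : Fin J → ℝ}
  {X : (n : ℕ) → (i : Fin J) → Fin (m n i) → Ω → EuclideanSpace ℝ (Fin d)}
  [IsProbabilityMeasure μ]

namespace IsSamplingScheme

theorem tendsto_measure_ovoPlus (h : IsSamplingScheme μ f m π X) (hd : 0 < d) (hJ : 0 < J)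
    {K : ℕ → Fin J → Fin J → ℕ}
    (hK : ∀ i j, i ≠ j → Tendsto (fun n => K n i j) atTop atTop ∧
      Tendsto (fun n : ℕ => (K n i j : ℝ) / (n : ℝ)) atTop (𝓝 0))
    (tie : ℕ → TieRule J) (x : EuclideanSpace ℝ (Fin d)) :
    Tendsto (fun n => μ {ω | ∀ j,
        f j x ≤ f (ovoPlus (tie n) (K n) (fun i l => X n i l ω) x) x}) atTop (𝓝 1) := by
  have hJ' : (Finset.univ : Finset (Fin J)).Nonempty := ⟨⟨0, hJ⟩, Finset.mem_univ _⟩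
  refine tendsto_measure_one_of_compl_subset (ι := (Fin J × Fin J) ⊕ (Fin J × Fin J))
    (W := Sum.elim
      (fun q n => {ω | f q.2 x < f q.1 x ∧
        MinorityWins (fun i l => X n i l ω) x {q.1} {q.2} (K n q.1 q.2)})
      (fun q n => {ω | f q.1 x < f q.2 x ∧
        ¬ MinorityWins (fun i l => X n i l ω) x {q.1} {q.2} (K n q.1 q.2)})) ?_ ?_
  · rintro (⟨j, c⟩ | ⟨j, c⟩)
    · by_cases hlt : f c x < f j x
      · have hjc : j ≠ c := fun e => hlt.ne (by rw [e])
        simp only [Sum.elim_inl, hlt, true_and]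
        refine h.tendsto_measure_minorityWins hd x (Finset.singleton_nonempty _)
          (Finset.singleton_nonempty _) ?_ (hK j c hjc).1 (hK j c hjc).2
        simp only [groupDensity, Finset.sum_singleton]
        have := mul_lt_mul_of_pos_left hlt (mul_pos (h.share_pos j) (h.share_pos c))
        linarith
      · simp [hlt]
    · by_cases hlt : f j x < f c x
      · have hjc : j ≠ c := fun e => hlt.ne (by rw [e])
        simp only [Sum.elim_inr, hlt, true_and]
        refine h.tendsto_measure_not_minorityWins hd x (Finset.singleton_nonempty _)
          (Finset.singleton_nonempty _) (by simpa using hjc) ?_ (hK j c hjc).1 (hK j c hjc).2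
        simp only [groupDensity, Finset.sum_singleton]
        have := mul_lt_mul_of_pos_left hlt (mul_pos (h.share_pos j) (h.share_pos c))
        linarith
      · simp [hlt]
  · intro n ω hω j
    refine (le_ovoPlusOn (tie n) (K n) (fun i l => X n i l ω) x (fun i => f i x)
      (fun j c hlt hM => hω (Sum.inl (j, c)) ⟨hlt, hM⟩)
      (fun j c hlt => ?_) Finset.univ hJ').2 j (Finset.mem_univ _)
    by_contra hM
    exact hω (Sum.inr (j, c)) ⟨hlt, hM⟩

/-- The average density of the rest is a weighted mean of values at most `f i x`, one of them
strictly smaller. Which side is the minority may change with `n`, so the failure event is covered by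
the failures under both role assignments. -/
theorem tendsto_measure_not_ovrWins (h : IsSamplingScheme μ f m π X) (hd : 0 < d)
    {S : Finset (Fin J)} {i : Fin J} {K : ℕ → ℕ} (hK : Tendsto K atTop atTop)
    (hKn : Tendsto (fun n : ℕ => (K n : ℝ) / n) atTop (𝓝 0))
    (tie : ℕ → TieRule J) (x : EuclideanSpace ℝ (Fin d)) (hmax : ∀ j ∈ S, f j x ≤ f i x)
    (hlt : ∃ j ∈ S, f j x < f i x) :
    Tendsto (fun n => μ.real {ω | ¬ OvrWins (tie n) (K n) (fun i l => X n i l ω) x S i})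
      atTop (𝓝 0) := by
  obtain ⟨j, hj, hji⟩ := hlt
  have hjS : j ∈ S.erase i := Finset.mem_erase.2 ⟨fun e => hji.ne (by rw [e]), hj⟩
  have hb : groupDensity f π x (S.erase i) < (∑ l ∈ S.erase i, π l) * f i x := by
    rw [groupDensity, Finset.sum_mul]
    exact Finset.sum_lt_sum
      (fun l hl => mul_le_mul_of_nonneg_left (hmax l (Finset.mem_of_mem_erase hl))
        (h.share_pos l).le)
      ⟨j, hjS, mul_lt_mul_of_pos_left hji (h.share_pos j)⟩
  have hb' := mul_lt_mul_of_pos_left hb (h.share_pos i)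
  have e1 := h.tendsto_measure_not_minorityWins hd x ⟨j, hjS⟩ (Finset.singleton_nonempty i)
    (by simp) (by simp only [groupDensity, Finset.sum_singleton] at hb' ⊢; linarith) hK hKn
  have e2 := h.tendsto_measure_minorityWins hd x (Finset.singleton_nonempty i) ⟨j, hjS⟩
    (by simp only [groupDensity, Finset.sum_singleton] at hb' ⊢; linarith) hK hKn
  refine squeeze_zero (fun _ => measureReal_nonneg) (fun n => ?_) (by simpa using e1.add e2)
  refine (measureReal_mono fun ω hω => ?_).trans (measureReal_union_le _ _)
  simp only [Set.mem_ofPred_eq, OvrWins] at hω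
  split_ifs at hω with hc
  · exact Or.inl hω
  · exact Or.inr (not_not.1 hω)

theorem tendsto_measure_ovrWins (h : IsSamplingScheme μ f m π X) (hd : 0 < d)
    {S : Finset (Fin J)} {i : Fin J} {K : ℕ → ℕ} (hK : Tendsto K atTop atTop)
    (hKn : Tendsto (fun n : ℕ => (K n : ℝ) / n) atTop (𝓝 0))
    (tie : ℕ → TieRule J) (x : EuclideanSpace ℝ (Fin d)) (hmin : ∀ j ∈ S, f i x ≤ f j x)
    (hlt : ∃ j ∈ S, f i x < f j x) :
    Tendsto (fun n => μ.real {ω | OvrWins (tie n) (K n) (fun i l => X n i l ω) x S i})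
      atTop (𝓝 0) := by
  obtain ⟨j, hj, hji⟩ := hlt
  have hjS : j ∈ S.erase i := Finset.mem_erase.2 ⟨fun e => hji.ne' (by rw [e]), hj⟩
  have hb : (∑ l ∈ S.erase i, π l) * f i x < groupDensity f π x (S.erase i) := by
    rw [groupDensity, Finset.sum_mul]
    exact Finset.sum_lt_sum
      (fun l hl => mul_le_mul_of_nonneg_left (hmin l (Finset.mem_of_mem_erase hl))
        (h.share_pos l).le)
      ⟨j, hjS, mul_lt_mul_of_pos_left hji (h.share_pos j)⟩
  have hb' := mul_lt_mul_of_pos_left hb (h.share_pos i)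
  have e1 := h.tendsto_measure_minorityWins hd x ⟨j, hjS⟩ (Finset.singleton_nonempty i)
    (by simp only [groupDensity, Finset.sum_singleton] at hb' ⊢; linarith) hK hKn
  have e2 := h.tendsto_measure_not_minorityWins hd x (Finset.singleton_nonempty i) ⟨j, hjS⟩
    (by simp) (by simp only [groupDensity, Finset.sum_singleton] at hb' ⊢; linarith) hK hKn
  refine squeeze_zero (fun _ => measureReal_nonneg) (fun n => ?_) (by simpa using e1.add e2)
  refine (measureReal_mono fun ω hω => ?_).trans (measureReal_union_le _ _)
  simp only [Set.mem_ofPred_eq, OvrWins] at hω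
  split_ifs at hω with hc
  · exact Or.inl hω
  · exact Or.inr hω

theorem tendsto_measure_ovrPlus (h : IsSamplingScheme μ f m π X) (hd : 0 < d) (hJ : 0 < J)
    {K : ℕ → Finset (Fin J) → Fin J → ℕ}
    (hK : ∀ S : Finset (Fin J), ∀ i ∈ S, 2 ≤ S.card →
      Tendsto (fun n => K n S i) atTop atTop ∧
      Tendsto (fun n : ℕ => (K n S i : ℝ) / (n : ℝ)) atTop (𝓝 0))
    (tie : ℕ → TieRule J) (x : EuclideanSpace ℝ (Fin d)) :
    Tendsto (fun n => μ {ω | ∀ j,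
        f j x ≤ f (ovrPlus (tie n) (K n) (fun i l => X n i l ω) x) x}) atTop (𝓝 1) := by
  have hJ' : (Finset.univ : Finset (Fin J)).Nonempty := ⟨⟨0, hJ⟩, Finset.mem_univ _⟩
  have hcard : ∀ {S : Finset (Fin J)} {i j : Fin J}, i ∈ S → j ∈ S → i ≠ j → 2 ≤ S.card :=
    fun hi hj hij => Finset.one_lt_card.2 ⟨_, hi, _, hj, hij⟩
  refine tendsto_measure_one_of_compl_subset
    (ι := (Finset (Fin J) × Fin J) ⊕ (Finset (Fin J) × Fin J))
    (W := Sum.elim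
      (fun q n => {ω | (q.2 ∈ q.1 ∧ (∀ j ∈ q.1, f j x ≤ f q.2 x) ∧ ∃ j ∈ q.1, f j x < f q.2 x) ∧
        ¬ OvrWins (tie n) (K n q.1 q.2) (fun i l => X n i l ω) x q.1 q.2})
      (fun q n => {ω | (q.2 ∈ q.1 ∧ (∀ j ∈ q.1, f q.2 x ≤ f j x) ∧ ∃ j ∈ q.1, f q.2 x < f j x) ∧
        OvrWins (tie n) (K n q.1 q.2) (fun i l => X n i l ω) x q.1 q.2})) ?_ ?_
  · rintro (⟨S, i⟩ | ⟨S, i⟩)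
    · by_cases hc : i ∈ S ∧ (∀ j ∈ S, f j x ≤ f i x) ∧ ∃ j ∈ S, f j x < f i x
      · obtain ⟨hi, hmax, j, hj, hlt⟩ := hc
        have hKS := hK S i hi (hcard hi hj fun e => hlt.ne' (by rw [e]))
        exact squeeze_zero (fun _ => measureReal_nonneg)
          (fun n => measureReal_mono fun ω hω => hω.2)
          (h.tendsto_measure_not_ovrWins hd hKS.1 hKS.2 tie x hmax ⟨j, hj, hlt⟩)
      · simp only [Sum.elim_inl, hc, false_and]
        simp
    · by_cases hc : i ∈ S ∧ (∀ j ∈ S, f i x ≤ f j x) ∧ ∃ j ∈ S, f i x < f j x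
      · obtain ⟨hi, hmin, j, hj, hlt⟩ := hc
        have hKS := hK S i hi (hcard hi hj fun e => hlt.ne (by rw [e]))
        exact squeeze_zero (fun _ => measureReal_nonneg)
          (fun n => measureReal_mono fun ω hω => hω.2)
          (h.tendsto_measure_ovrWins hd hKS.1 hKS.2 tie x hmin ⟨j, hj, hlt⟩)
      · simp only [Sum.elim_inr, hc, false_and]
        simp
  · intro n ω hω j
    refine (le_ovrPlusOn (tie n) (K n) (fun i l => X n i l ω) x (fun i => f i x)
      (fun S i hi hmax hlt => ?_)
      (fun S i hi hmin hlt hw => hω (Sum.inr (S, i)) ⟨⟨hi, hmin, hlt⟩, hw⟩)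
      Finset.univ hJ').2 j (Finset.mem_univ _)
    by_contra hw
    exact hω (Sum.inl (S, i)) ⟨⟨hi, hmax, hlt⟩, hw⟩

end IsSamplingScheme

/-- On the zero-dimensional space all probability densities agree. -/
theorem density_eq_of_dim_zero {f g : EuclideanSpace ℝ (Fin 0) → ℝ} (hf0 : ∀ y, 0 ≤ f y)
    (hg0 : ∀ y, 0 ≤ g y) (hf : ∫⁻ y, ENNReal.ofReal (f y) = 1)
    (hg : ∫⁻ y, ENNReal.ofReal (g y) = 1) (x : EuclideanSpace ℝ (Fin 0)) : f x = g x := by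
  have key : ∀ u : EuclideanSpace ℝ (Fin 0) → ℝ, ∫⁻ y, ENNReal.ofReal (u y) = 1 →
      ENNReal.ofReal (u x) * volume (Set.univ : Set (EuclideanSpace ℝ (Fin 0))) = 1 := by
    intro u hu
    rw [← lintegral_const, ← hu]
    exact lintegral_congr fun y => by rw [Subsingleton.elim y x]
  have h1 := ENNReal.eq_inv_of_mul_eq_one_left (key f hf)
  have h2 := ENNReal.eq_inv_of_mul_eq_one_left (key g hg)
  exact (ENNReal.ofReal_eq_ofReal_iff (hf0 x) (hg0 x)).1 (h1.trans h2.symm)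

end

end NNClass

theorem theorem2 {d J : ℕ} {Ω : Type*} [MeasurableSpace Ω] (μ : Measure Ω)
    [IsProbabilityMeasure μ]
    -- continuous probability densities of the classes
    (f : Fin J → EuclideanSpace ℝ (Fin d) → ℝ)
    (hf_cont : ∀ i, Continuous (f i)) (hf_nonneg : ∀ i y, 0 ≤ f i y)
    (hf_prob : ∀ i, ∫⁻ y, ENNReal.ofReal (f i y) = 1)
    -- class sample sizes `m n i`, out of a total of `n` observations
    (m : ℕ → Fin J → ℕ) (hm : ∀ n, ∑ i, m n i = n)
    (π : Fin J → ℝ) (hπ : ∀ i, π i ∈ Set.Ioo (0 : ℝ) 1)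
    (hmπ : ∀ i, Tendsto (fun n : ℕ => (m n i : ℝ) / (n : ℝ)) atTop (𝓝 (π i)))
    -- independent training observations, those of class `i` with density `f i`
    (X : (n : ℕ) → (i : Fin J) → Fin (m n i) → Ω → EuclideanSpace ℝ (Fin d))
    (hX_law : ∀ n i j, HasLaw (X n i j)
      ((volume : Measure (EuclideanSpace ℝ (Fin d))).withDensity
        fun y => ENNReal.ofReal (f i y)) μ)
    (hX_indep : ∀ n, iIndepFun (fun p : (i : Fin J) × Fin (m n i) => X n p.1 p.2) μ)
    -- the values of `k_max` in the binary problems of the two methods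
    (kOvO : ℕ → Fin J → Fin J → ℕ)
    (hkOvO : ∀ i j, i ≠ j → Tendsto (fun n => kOvO n i j) atTop atTop ∧
      Tendsto (fun n : ℕ => (kOvO n i j : ℝ) / (n : ℝ)) atTop (𝓝 0))
    (kOvR : ℕ → Finset (Fin J) → Fin J → ℕ)
    (hkOvR : ∀ S : Finset (Fin J), ∀ i ∈ S, 2 ≤ S.card →
      Tendsto (fun n => kOvR n S i) atTop atTop ∧
      Tendsto (fun n : ℕ => (kOvR n S i : ℝ) / (n : ℝ)) atTop (𝓝 0))
    -- arbitrary resolution of ties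
    (tie : ℕ → NNClass.TieRule J)
    (x : EuclideanSpace ℝ (Fin d)) :
    Tendsto (fun n => μ {ω | ∀ j,
        f j x ≤ f (NNClass.ovoPlus (tie n) (kOvO n) (fun i l => X n i l ω) x) x})
      atTop (𝓝 1) ∧
    Tendsto (fun n => μ {ω | ∀ j,
        f j x ≤ f (NNClass.ovrPlus (tie n) (kOvR n) (fun i l => X n i l ω) x) x})
      atTop (𝓝 1) := by
  have hJ : 0 < J := by
    rcases Nat.eq_zero_or_pos J with rfl | hJ
    · simpa using hm 1
    · exact hJ
  -- For `d = 0` there are no balls of small positive volume, but all densities agree at the only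
  -- point, so every class is a maximizer.
  rcases Nat.eq_zero_or_pos d with rfl | hd
  · have heq : ∀ i j, f i x ≤ f j x := fun i j =>
      (NNClass.density_eq_of_dim_zero (hf_nonneg i) (hf_nonneg j) (hf_prob i) (hf_prob j) x).le
    simp [heq]
  · have h : NNClass.IsSamplingScheme μ f m π X :=
      ⟨hf_cont, hf_nonneg, fun i => (hπ i).1, hmπ, fun n => ⟨hX_law n, hX_indep n⟩⟩
    exact ⟨h.tendsto_measure_ovoPlus hd hJ hkOvO tie x,
      h.tendsto_measure_ovrPlus hd hJ hkOvR tie x⟩
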